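/- Let $k$ be a commutative unital ring and let $A$ be a commutative $k$-algebra with an augmentation $\varepsilon\colon A\to k$ (a $k$-algebra homomorphism) and augmentation ideal $I=\ker\varepsilon$. Write $\underline{n}=\{1,\dots,n\}$ for $n\ge 1$. **Categories.** Let $\Omega$ be the category of the sets $\underline{n}$, $n\geq 1$, and surjections. Let $\Delta S$ be the category with the same objects whose morphisms $\underline n\to\underline m$ are pairs $(\varphi,g)$ with $g\in\Sigma_n$ and $\varphi\colon\underline n\to\underline m$ order-preserving. The composite is $(\psi,h)\circ(\varphi,g)=(\psi\circ h_\star(\varphi),\varphi^\star(h)\circ g)$, where $h_\star(\varphi)$ is order-preserving, $\varphi^\star(h)$ is a permutation that is order-preserving on each fibre of $\varphi$, and $h_\star(\varphi)\circ\varphi^\star(h)=h\circ\varphi$. Let $\mathrm{Epi}\Delta S$ be the subcategory of all objects and the epimorphisms, and let $U\colon \mathrm{Epi}\Delta S\to\Omega$, $(\varphi,g)\mapsto\varphi\circ g$, be the functor that forgets the orderings of the fibres. Let $B_I^{sym}\colon\mathrm{Epi}\Delta S\to k\text{-}\mathrm{Mod}$ be the functor with $B_I^{sym}(\underline n)=I^{\otimes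 n}$, where $(\varphi,g)$ acts by $a_1\otimes\cdots\otimes a_n\mapsto\bigotimes_{j}\prod_{i\in\varphi^{-1}(j)}a_{g^{-1}(i)}$. **The symmetric complex.** Let $CS_\star(I)=C_\star(\mathrm{Epi}\Delta S,B_I^{sym})$ be the simplicial $k$-module with $$CS_n(I)=\bigoplus_{\underline x\xrightarrow{f_1}\underline{x_1}\to\cdots\xrightarrow{f_n}\underline{x_n}} I^{\otimes x},$$ the sum being over strings of composable morphisms of $\mathrm{Epi}\Delta S$. Its faces are $\partial_0(f_n,\dots,f_1,y)=(f_n,\dots,f_2,B_I^{sym}(f_1)(y))$; $\partial_i$ composes $f_{i+1}\circ f_i$ for $0<i<n$; and $\partial_n$ omits $f_n$. Its degeneracies insert identities. Let $NCS_\star(I)$ be its normalized chain complex (the associated complex modulo degenerate elements), let $NCS^1_\star(I)$ be the subcomplex generated by the classes of generators with $\underline{x_n}\ne\underline 1$, and let $q\colon NCS_\star(I)\to\overline{NCS_\star(I)}=NCS_\star(I)/NCS_\star^1(I)$ be the quotient map. **The Robinson–Whitehouse complex.** Let $C\Gamma_\star(I,k)$ be the simplicial $k$-module with $$C\Gamma_n(I,k)=\bigoplus_{x\ge1}k[N\Omega_n(\underline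 x,\underline 1)]\otimes I^{\otimes x}\otimes k,$$ where $N\Omega_n(\underline x,\underline 1)$ is the set of strings $[f_n|\cdots|f_1]$ of $n$ composable morphisms of $\Omega$ from $\underline x$ to $\underline 1$, and where $A$ acts on the last factor $k$ through $\varepsilon$. The face $\partial_0$ sends $[f_n|\cdots|f_1]\otimes a\otimes m$ to $[f_n|\cdots|f_2]\otimes f_{1\star}(a)\otimes m$, where $f_{1\star}$ permutes and multiplies tensor factors; $\partial_i$ composes $f_{i+1}\circ f_i$ for $0<i<n$; and $$\partial_n\big([f_n|\cdots|f_1]\otimes a\otimes m\big)=\sum_{i\in\underline{x_{n-1}}}[f_{n-1}^i|\cdots|f_1^i]\otimes(a_{i_1}\otimes\cdots\otimes a_{i_r})\otimes\Big(\prod_{j\notin\{i_1,\dots,i_r\}}a_j\Big)m,$$ where $i_1<\cdots<i_r$ are the elements of the preimage of $i$ in $\underline x$ and $[f_{n-1}^i|\cdots|f_1^i]$ is the string of the preimages of $i$, re-indexed in the order-preserving way. The degeneracies insert identities. Let $NC\Gamma_\star(I,k)$ be its normalized chain complex. **Theorem.** There is a map of chain complexes $\Phi\colon\overline{NCS_\star(I)}\to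 NC\Gamma_\star(I,k)$, given in every degree $n\ge 0$ on the class of a generator with $\underline{x_n}=\underline 1$ and $y\in I^{\otimes x}$ by $$\Phi_n\big[(f_n,\dots,f_1),y\big]=\big[[U(f_n)|\cdots|U(f_1)]\otimes y\otimes 1_k\big],$$ and the composite map of chain complexes $\Phi\circ q\colon NCS_\star(I)\to NC\Gamma_\star(I,k)$ is surjective in every degree. -/

import Mathlib

open CategoryTheory
open scoped TensorProduct Simplicial

namespace SymGamma

universe u v w

/-! ### The categories -/

/-- Objects of the category `Ω`: the sets `{1, …, n}` with `n ≥ 1`, modelled as `Fin n`. -/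
@[ext]
structure Omega : Type where
  card : ℕ
  pos : 0 < card

/-- Morphisms of `Ω` are the surjections of sets. -/
instance : Category.{0} Omega where
  Hom a b := {f : Fin a.card → Fin b.card // Function.Surjective f}
  id _ := ⟨id, Function.surjective_id⟩
  comp f g := ⟨g.1 ∘ f.1, g.2.comp f.2⟩

/-- Objects of the category `ΔS`: the sets `{1, …, n}` with `n ≥ 1`, modelled as `Fin n`. -/
@[ext]
structure DeltaS : Type where
  card : ℕ
  pos : 0 < card

/-- A morphism `n ⟶ m` of `ΔS` is a pair `(φ, g)` of an order-preserving map `φ : n → m` and a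
permutation `g` of `n`. -/
@[ext]
structure DeltaS.Hom (a b : DeltaS) : Type where
  φ : Fin a.card →o Fin b.card
  g : Equiv.Perm (Fin a.card)

/-- The map of sets `φ ∘ g` underlying the morphism `(φ, g)` of `ΔS`. -/
def DeltaS.Hom.toFun {a b : DeltaS} (f : DeltaS.Hom a b) : Fin a.card → Fin b.card :=
  fun i => f.φ (f.g i)

/-- For `φ : n → m` order-preserving and `h` a permutation of `m`, the permutation `φ^*(h)` of `n`:
it carries the fibres of `φ`, as blocks, into the order prescribed by `h`, and is
order-preserving on each fibre. (`Tuple.sort` is the stable sorting permutation.) -/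
def DeltaS.pullPerm {n m : ℕ} (φ : Fin n →o Fin m) (h : Equiv.Perm (Fin m)) :
    Equiv.Perm (Fin n) :=
  (Tuple.sort (fun i => h (φ i)))⁻¹

/-- For `φ : n → m` order-preserving and `h` a permutation of `m`, the order-preserving map
`h_*(φ)`, characterised by `h_*(φ) ∘ φ^*(h) = h ∘ φ`. -/
def DeltaS.pushMap {n m : ℕ} (φ : Fin n →o Fin m) (h : Equiv.Perm (Fin m)) :
    Fin n →o Fin m :=
  ⟨fun i => h (φ ((DeltaS.pullPerm φ h)⁻¹ i)), by
    have := Tuple.monotone_sort (fun i => h (φ i))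
    simpa [DeltaS.pullPerm, Function.comp_def] using this⟩

/-- Composition in `ΔS`: `(ψ, h) ∘ (φ, g) = (ψ ∘ h_*(φ), φ^*(h) ∘ g)`. -/
def DeltaS.Hom.comp {a b c : DeltaS} (f : DeltaS.Hom a b) (f' : DeltaS.Hom b c) :
    DeltaS.Hom a c where
  φ := f'.φ.comp (DeltaS.pushMap f.φ f'.g)
  g := DeltaS.pullPerm f.φ f'.g * f.g

theorem DeltaS.pullPerm_eq_iff {n m : ℕ} (φ : Fin n →o Fin m) (h : Equiv.Perm (Fin m))
    (p : Equiv.Perm (Fin n)) :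
    DeltaS.pullPerm φ h = p ↔ (Monotone fun i => h (φ (p⁻¹ i))) ∧
      ∀ i j, i < j → φ (p⁻¹ i) = φ (p⁻¹ j) → p⁻¹ i < p⁻¹ j := by
  rw [DeltaS.pullPerm, inv_eq_iff_eq_inv, eq_comm, Tuple.eq_sort_iff]
  simp [Function.comp_def]

theorem DeltaS.Hom.comp_toFun {a b c : DeltaS} (f : DeltaS.Hom a b) (f' : DeltaS.Hom b c)
    (i : Fin a.card) : (f.comp f').toFun i = f'.toFun (f.toFun i) := by
  simp [DeltaS.Hom.comp, DeltaS.Hom.toFun, DeltaS.pushMap]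

theorem DeltaS.pullPerm_one {n m : ℕ} (φ : Fin n →o Fin m) :
    DeltaS.pullPerm φ 1 = 1 := by
  rw [DeltaS.pullPerm_eq_iff]
  exact ⟨by simpa using φ.monotone, fun i j h _ => by simpa using h⟩

theorem DeltaS.pullPerm_id {n : ℕ} (h : Equiv.Perm (Fin n)) :
    DeltaS.pullPerm OrderHom.id h = h := by
  rw [DeltaS.pullPerm_eq_iff]
  refine ⟨fun x y h => by simpa using h, fun i j hij he => ?_⟩
  have : i = j := by simpa using he
  exact absurd this hij.ne

/-- A morphism of `ΔS` is determined by its permutation and its underlying map. -/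
theorem DeltaS.Hom.ext_toFun {a b : DeltaS} {f f' : DeltaS.Hom a b} (hg : f.g = f'.g)
    (h : ∀ i, f.toFun i = f'.toFun i) : f = f' := by
  refine DeltaS.Hom.ext ?_ hg
  ext i : 2
  have := h (f.g⁻¹ i)
  simp only [DeltaS.Hom.toFun, ← hg] at this
  simpa using this

theorem DeltaS.Hom.assoc_g {a b c d : DeltaS} (f₁ : DeltaS.Hom a b) (f₂ : DeltaS.Hom b c)
    (f₃ : DeltaS.Hom c d) : ((f₁.comp f₂).comp f₃).g = (f₁.comp (f₂.comp f₃)).g := by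
  change DeltaS.pullPerm (f₁.comp f₂).φ f₃.g * (DeltaS.pullPerm f₁.φ f₂.g * f₁.g) =
    DeltaS.pullPerm f₁.φ (DeltaS.pullPerm f₂.φ f₃.g * f₂.g) * f₁.g
  rw [← mul_assoc]
  congr 1
  symm
  obtain ⟨m₁, t₁⟩ := (DeltaS.pullPerm_eq_iff f₁.φ f₂.g _).1 rfl
  obtain ⟨m₂, t₂⟩ := (DeltaS.pullPerm_eq_iff f₂.φ f₃.g _).1 rfl
  obtain ⟨m₃, t₃⟩ := (DeltaS.pullPerm_eq_iff (f₁.comp f₂).φ f₃.g _).1 rfl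
  have e : ∀ i, (f₁.comp f₂).φ i = f₂.φ (f₂.g (f₁.φ ((DeltaS.pullPerm f₁.φ f₂.g)⁻¹ i))) :=
    fun i => rfl
  rw [DeltaS.pullPerm_eq_iff]
  generalize DeltaS.pullPerm f₁.φ f₂.g = p₁ at *
  generalize DeltaS.pullPerm f₂.φ f₃.g = p₂ at *
  generalize DeltaS.pullPerm (f₁.comp f₂).φ f₃.g = p₃ at *
  simp only [mul_inv_rev, Equiv.Perm.mul_apply]
  simp only [e] at m₃ t₃
  refine ⟨fun i j hij => ?_, fun i j hij he => ?_⟩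
  · by_contra hlt
    rw [not_le] at hlt
    have hle := m₂ hlt.le
    simp only [Equiv.Perm.coe_inv, Equiv.symm_apply_apply] at hle hlt ⊢
    have heq := le_antisymm hle (m₃ hij)
    have hne : i ≠ j := by rintro rfl; exact lt_irrefl _ hlt
    have h1 := t₂ _ _ hlt (by simpa using heq)
    simp only [Equiv.Perm.coe_inv, Equiv.symm_apply_apply] at h1
    have h2 := t₃ i j (lt_of_le_of_ne hij hne) (by simpa using heq.symm)
    exact absurd (m₁ h2.le) (not_le.2 h1)
  · exact t₁ _ _ (t₃ i j hij (by rw [he])) he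

instance : Category.{0} DeltaS where
  Hom := DeltaS.Hom
  id _ := ⟨OrderHom.id, 1⟩
  comp := DeltaS.Hom.comp
  id_comp f := by
    refine DeltaS.Hom.ext_toFun ?_ fun i => ?_
    · simp [DeltaS.Hom.comp, DeltaS.pullPerm_id]
    · rw [DeltaS.Hom.comp_toFun]; rfl
  comp_id f := by
    refine DeltaS.Hom.ext_toFun ?_ fun i => ?_
    · simp [DeltaS.Hom.comp, DeltaS.pullPerm_one]
    · rw [DeltaS.Hom.comp_toFun]; rfl
  assoc f₁ f₂ f₃ := by
    refine DeltaS.Hom.ext_toFun (DeltaS.Hom.assoc_g f₁ f₂ f₃) fun i => ?_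
    simp only [DeltaS.Hom.comp_toFun]

theorem DeltaS.toFun_comp {a b c : DeltaS} (f : a ⟶ b) (f' : b ⟶ c) :
    DeltaS.Hom.toFun (f ≫ f') = DeltaS.Hom.toFun f' ∘ DeltaS.Hom.toFun f :=
  funext fun i => DeltaS.Hom.comp_toFun f f' i

/-- The map of sets underlying an epimorphism of `ΔS` is surjective. -/
theorem DeltaS.surjective_of_epi {a b : DeltaS} (f : a ⟶ b) [Epi f] :
    Function.Surjective (DeltaS.Hom.toFun f) := by
  by_contra hns
  simp only [Function.Surjective, not_forall, not_exists] at hns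
  obtain ⟨j, hj⟩ := hns
  let two : DeltaS := ⟨2, by norm_num⟩
  let φ₁ : Fin b.card →o Fin 2 := ⟨fun i => if i ≤ j then 0 else 1, by
    intro x y hxy
    dsimp only
    split_ifs <;> omega⟩
  let φ₂ : Fin b.card →o Fin 2 := ⟨fun i => if i < j then 0 else 1, by
    intro x y hxy
    dsimp only
    split_ifs <;> omega⟩
  let h₁ : b ⟶ two := (⟨φ₁, 1⟩ : DeltaS.Hom b two)
  let h₂ : b ⟶ two := (⟨φ₂, 1⟩ : DeltaS.Hom b two)
  have key : f ≫ h₁ = f ≫ h₂ := by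
    refine DeltaS.Hom.ext_toFun rfl fun i => ?_
    rw [DeltaS.toFun_comp, DeltaS.toFun_comp]
    change (if DeltaS.Hom.toFun f i ≤ j then (0 : Fin 2) else 1) =
      if DeltaS.Hom.toFun f i < j then (0 : Fin 2) else 1
    simp only [le_iff_lt_or_eq, hj i, or_false]
  have h3 : φ₁ j = φ₂ j :=
    congrArg (fun q => (DeltaS.Hom.φ q) j) ((cancel_epi f).1 key)
  change (if j ≤ j then (0 : Fin 2) else 1) = if j < j then (0 : Fin 2) else 1 at h3
  simp at h3

/-- `Epi ΔS`: the subcategory of `ΔS` with all objects and the epimorphisms as morphisms. -/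
abbrev EpiDeltaS : Type := WideSubcategory (MorphismProperty.epimorphisms DeltaS)

theorem EpiDeltaS.surjective {a b : EpiDeltaS} (f : a ⟶ b) :
    Function.Surjective (DeltaS.Hom.toFun f.hom) :=
  have : Epi f.hom := f.property
  DeltaS.surjective_of_epi f.hom

/-- The forgetful functor `U : Epi ΔS ⥤ Ω`: identity on objects, `(φ, g) ↦ φ ∘ g`. -/
def forgetOrder : EpiDeltaS ⥤ Omega where
  obj a := ⟨a.obj.card, a.obj.pos⟩
  map f := ⟨DeltaS.Hom.toFun f.hom, EpiDeltaS.surjective f⟩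
  map_id _ := rfl
  map_comp f f' := Subtype.ext (DeltaS.toFun_comp f.hom f'.hom)

/-! ### Quotient complexes and the normalized complex of a simplicial module -/

section Complexes

variable {k : Type u} [CommRing k]

/-- The quotient of a chain complex of `k`-modules by a subcomplex, given as a family of
submodules that is stable under the differentials. -/
noncomputable def quotientComplex (C : ChainComplex (ModuleCat.{w} k) ℕ)
    (D : ∀ n, Submodule k (C.X n)) (h : ∀ i j, D i ≤ (D j).comap (C.d i j).hom) :
    ChainComplex (ModuleCat.{w} k) ℕ where
  X n := ModuleCat.of k (C.X n ⧸ D n)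
  d i j := ModuleCat.ofHom ((D i).mapQ (D j) (C.d i j).hom (h i j))
  shape i j hij := by
    ext x
    have := C.shape i j hij
    simp [this]
  d_comp_d' i j l _ _ := by
    ext x
    have : (C.d j l).hom ((C.d i j).hom x) = 0 := by
      have := C.d_comp_d i j l
      exact congrArg (fun f => f.hom x) this
    simp [this]

/-- The quotient map onto a quotient complex. -/
noncomputable def quotientComplexMk (C : ChainComplex (ModuleCat.{w} k) ℕ)
    (D : ∀ n, Submodule k (C.X n)) (h : ∀ i j, D i ≤ (D j).comap (C.d i j).hom) :
    C ⟶ quotientComplex C D h where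
  f n := ModuleCat.ofHom (D n).mkQ
  comm' i j _ := by
    ext x
    rfl

/-- The degenerate elements of a simplicial `k`-module in degree `n`: the submodule generated by
the images of the degeneracy maps. -/
def degenerate (X : SimplicialObject (ModuleCat.{w} k)) (n : ℕ) :
    Submodule k (((AlgebraicTopology.alternatingFaceMapComplex _).obj X).X n) :=
  match n with
  | 0 => ⊥
  | n + 1 => ⨆ i : Fin (n + 1), LinearMap.range (X.σ i).hom

theorem range_σ_le (X : SimplicialObject (ModuleCat.{w} k)) {n : ℕ} (i : Fin (n + 1)) :
    LinearMap.range (X.σ i).hom ≤ degenerate X (n + 1) :=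
  le_iSup (fun i : Fin (n + 1) => LinearMap.range (X.σ i).hom) i

theorem degenerate_d (X : SimplicialObject (ModuleCat.{w} k)) (i j : ℕ) :
    degenerate X i ≤ (degenerate X j).comap
      (((AlgebraicTopology.alternatingFaceMapComplex _).obj X).d i j).hom := by
  by_cases hij : j + 1 = i
  swap
  · rw [HomologicalComplex.shape _ i j hij]
    intro x _
    simp
  subst hij
  refine iSup_le fun i => ?_
  rintro _ ⟨x, rfl⟩
  rw [Submodule.mem_comap, AlgebraicTopology.alternatingFaceMapComplex_obj_d,
    AlgebraicTopology.AlternatingFaceMapComplex.objD]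
  have key : ∀ l : Fin (j + 2), l ≠ i.castSucc → l ≠ i.succ →
      (X.δ l).hom ((X.σ i).hom x) ∈ degenerate X j := by
    intro l h1 h2
    obtain _ | m := j
    · exfalso
      have := i.isLt
      simp only [ne_eq, Fin.ext_iff, Fin.val_castSucc, Fin.val_succ] at h1 h2
      omega
    rcases lt_or_ge l i.castSucc with hl | hl
    · obtain ⟨i', rfl⟩ : ∃ i' : Fin (m + 1), i = i'.succ :=
        ⟨i.pred (by rintro rfl; simp at hl), by simp⟩
      obtain ⟨l', rfl⟩ : ∃ l' : Fin (m + 2), l = l'.castSucc :=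
        ⟨l.castLT (by
          have := i'.isLt
          rw [Fin.lt_def] at hl; simp at hl; omega), by simp⟩
      have := X.δ_comp_σ_of_le (i := l') (j := i') (by
        rw [Fin.lt_def] at hl; rw [Fin.le_def]; simp at hl ⊢; omega)
      refine range_σ_le X i' ⟨(X.δ l').hom x, ?_⟩
      exact (congrArg (fun f => f.hom x) this).symm
    · have hl' : i.succ < l := by
        rw [Fin.le_def] at hl; rw [Fin.lt_def]
        simp only [ne_eq, Fin.ext_iff, Fin.val_castSucc, Fin.val_succ] at h1 h2 hl ⊢
        omega
      obtain ⟨i', rfl⟩ : ∃ i' : Fin (m + 1), i = i'.castSucc :=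
        ⟨i.castLT (by
          have := l.isLt
          rw [Fin.lt_def] at hl'; simp at hl'; omega), by simp⟩
      obtain ⟨l', rfl⟩ : ∃ l' : Fin (m + 2), l = l'.succ :=
        ⟨l.pred (by rintro rfl; simp at hl'), by simp⟩
      have := X.δ_comp_σ_of_gt (i := l') (j := i') (by
        rw [Fin.lt_def] at hl' ⊢; simp at hl' ⊢; omega)
      refine range_σ_le X i' ⟨(X.δ l').hom x, ?_⟩
      exact (congrArg (fun f => f.hom x) this).symm
  have e1 : (X.δ i.castSucc).hom ((X.σ i).hom x) = x :=
    congrArg (fun f => f.hom x) (X.δ_comp_σ_self (i := i))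
  have e2 : (X.δ i.succ).hom ((X.σ i).hom x) = x :=
    congrArg (fun f => f.hom x) (X.δ_comp_σ_succ (i := i))
  rw [ModuleCat.hom_sum, LinearMap.sum_apply,
    ← Finset.add_sum_erase _ _ (Finset.mem_univ i.castSucc),
    ← Finset.add_sum_erase (Finset.univ.erase i.castSucc) _ (a := i.succ)
      (Finset.mem_erase.2 ⟨(Fin.castSucc_lt_succ).ne', Finset.mem_univ _⟩), ← add_assoc]
  refine Submodule.add_mem _ ?_ (Submodule.sum_mem _ fun l hl => ?_)
  · simp only [ModuleCat.hom_zsmul, LinearMap.smul_apply, e1, e2, Fin.val_castSucc, Fin.val_succ,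
      pow_succ]
    simp
  · simp only [Finset.mem_erase] at hl
    rw [ModuleCat.hom_zsmul, LinearMap.smul_apply]
    exact zsmul_mem (key l hl.2.1 hl.1) _

/-- The normalized chain complex of a simplicial `k`-module: the quotient of the associated chain
complex (with differential the alternating sum of the face maps) by the degenerate elements. -/
noncomputable def normalizedComplex (X : SimplicialObject (ModuleCat.{w} k)) :
    ChainComplex (ModuleCat.{w} k) ℕ :=
  quotientComplex ((AlgebraicTopology.alternatingFaceMapComplex _).obj X) (degenerate X)
    (degenerate_d X)

/-- The class in the normalized complex of an element of a simplicial `k`-module. -/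
noncomputable def normalizedMk (X : SimplicialObject (ModuleCat.{w} k)) (n : ℕ) :
    X _⦋n⦌ →ₗ[k] (normalizedComplex X).X n :=
  (degenerate X n).mkQ

end Complexes

/-! ### The Gabriel–Zisman complex -/

section GabrielZisman

variable {k : Type u} [CommRing k] {C : Type} [SmallCategory C] 

/-- The string obtained from a string of `n` composable morphisms by a map `⦋m⦌ ⟶ ⦋n⦌` in the
simplex category; this is the simplicial structure of the nerve of `C`. -/
abbrev pullString {x y : SimplexCategory} (θ : y ⟶ x) (s : ComposableArrows C x.len) :
    ComposableArrows C y.len :=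
  θ.toOrderHom.monotone.functor ⋙ s

/-- The morphism from the initial object of the string `s` to the initial object of
`pullString θ s`; for the `0`-th face it is the first morphism of the string. -/
abbrev initialMap {x y : SimplexCategory} (θ : y ⟶ x) (s : ComposableArrows C x.len) :
    s.obj 0 ⟶ (pullString θ s).obj 0 :=
  s.map (homOfLE (Fin.zero_le _))

open Classical in
/-- The inclusion of the summand of `C_n(C, F)` indexed by the string `s`. -/
noncomputable abbrev gzIncl (F : C ⥤ ModuleCat.{w} k) (n : ℕ) (s : ComposableArrows C n) :
    F.obj (s.obj 0) →ₗ[k] DirectSum (ComposableArrows C n) fun s => F.obj (s.obj 0) :=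
  DirectSum.lof k (ComposableArrows C n) (fun s => F.obj (s.obj 0)) s

open Classical in
/-- The map of `C_*(C, F)` induced by a map `θ` of the simplex category: it sends the
generator `(s, x)` to `(θ^* s, F(C_0 ⟶ C_{θ 0}) x)`. -/
noncomputable def gzMap (F : C ⥤ ModuleCat.{w} k) {x y : SimplexCategory} (θ : y ⟶ x) :
    (DirectSum (ComposableArrows C x.len) fun s => F.obj (s.obj 0)) →ₗ[k]
      DirectSum (ComposableArrows C y.len) fun s => F.obj (s.obj 0) :=
  DirectSum.toModule k _ _ fun s =>
    gzIncl F y.len (pullString θ s) ∘ₗ (F.map (initialMap θ s)).hom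

theorem gzMap_incl (F : C ⥤ ModuleCat.{w} k) {x y : SimplexCategory} (θ : y ⟶ x)
    (s : ComposableArrows C x.len) (a : F.obj (s.obj 0)) :
    gzMap F θ (gzIncl F x.len s a) =
      gzIncl F y.len (pullString θ s) ((F.map (initialMap θ s)).hom a) := by
  rw [gzMap, DirectSum.toModule_lof]
  rfl

/-- The simplicial `k`-module `C_*(C, F)`. In degree `n` it is the direct sum of the modules
`F(C_0)` over the strings `C_0 ⟶ ⋯ ⟶ C_n`, and a map `θ` of the simplex category sends the
generator `(s, x)` to `(θ^* s, F(C_0 ⟶ C_{θ 0}) x)`. So the `0`-th face sends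
`(f_n, …, f_1, x)` to `(f_n, …, f_2, F(f_1) x)`, the inner faces compose adjacent morphisms, the
last face forgets `f_n`, and the degeneracies insert identities. -/
noncomputable def gabrielZisman (F : C ⥤ ModuleCat.{w} k) :
    SimplicialObject (ModuleCat.{w} k) where
  obj x := ModuleCat.of k (DirectSum (ComposableArrows C x.unop.len) fun s => F.obj (s.obj 0))
  map {x y} θ := ModuleCat.ofHom (gzMap F θ.unop)
  map_id x := by
    classical
    refine ModuleCat.hom_ext (DirectSum.linearMap_ext _ fun s => LinearMap.ext fun a => ?_)
    refine (gzMap_incl F (𝟙 x.unop) s a).trans ?_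
    have h : (F.map (s.map (𝟙 (0 : Fin (x.unop.len + 1))))).hom a = a := by
      rw [s.map_id, F.map_id]; rfl
    exact congrArg (gzIncl F x.unop.len s) h
  map_comp {x y z} θ η := by
    classical
    refine ModuleCat.hom_ext (DirectSum.linearMap_ext _ fun s => LinearMap.ext fun a => ?_)
    refine (gzMap_incl F (η.unop ≫ θ.unop) s a).trans ?_
    refine Eq.trans ?_ (congrArg (gzMap F η.unop) (gzMap_incl F θ.unop s a)).symm
    refine Eq.trans ?_ (gzMap_incl F η.unop _ _).symm
    refine congrArg (gzIncl F z.unop.len (pullString (η.unop ≫ θ.unop) s)) ?_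
    have h : initialMap (η.unop ≫ θ.unop) s =
        initialMap θ.unop s ≫ s.map (homOfLE (θ.unop.toOrderHom.monotone (Fin.zero_le
          (η.unop.toOrderHom 0)))) := by
      rw [← s.map_comp]
      rfl
    refine (congrArg (fun f => (F.map f).hom a) h).trans ?_
    exact LinearMap.congr_fun (congrArg ModuleCat.Hom.hom
      (F.map_comp (initialMap θ.unop s) (initialMap η.unop (pullString θ.unop s)))) a

/-- The generator `(s, x)` of `C_n(C, F)`. -/
noncomputable def gabrielZismanGen (F : C ⥤ ModuleCat.{w} k) {n : ℕ} (s : ComposableArrows C n)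
    (x : F.obj (s.obj 0)) : (gabrielZisman F) _⦋n⦌ :=
  gzIncl F n s x

end GabrielZisman

/-! ### Tensor powers of an ideal and the functor `B_I^sym` -/

section Tensor

variable (k : Type u) [CommRing k] {A : Type v} [CommRing A] [Algebra k A] (I : Ideal A)

/-- The tensor power `I^{⊗ n}` over `k`. -/
abbrev TPow (n : ℕ) : Type (max u v) := PiTensorProduct k fun _ : Fin n => I

variable {I} in
/-- For a surjection `f`, the tuple whose `j`-th entry is the product of the `a i` over
the (non-empty) fibre of `f` over `j`. -/
def pushVec {x y : ℕ} (f : Fin x → Fin y) (hf : Function.Surjective f) (a : Fin x → I) :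
    Fin y → I := fun j =>
  ⟨∏ i with f i = j, (a i : A), by
    obtain ⟨i, hi⟩ := hf j
    exact I.prod_mem (i := i) (by simpa using hi) (a i).2⟩

variable {I} in
theorem pushVec_coe {x y : ℕ} (f : Fin x → Fin y) (hf : Function.Surjective f) (a : Fin x → I)
    (j : Fin y) : (pushVec f hf a j : A) = ∏ i with f i = j, (a i : A) := rfl

variable {I} in
theorem pushVec_update {x y : ℕ} (f : Fin x → Fin y) (hf : Function.Surjective f)
    (a : Fin x → I) (i : Fin x) (b : I) :
    pushVec f hf (Function.update a i b) = Function.update (pushVec f hf a) (f i)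
      ⟨(∏ l ∈ (Finset.univ.filter fun l => f l = f i).erase i, (a l : A)) * b,
        I.mul_mem_left _ b.2⟩ := by
  funext j
  apply Subtype.ext
  rcases eq_or_ne j (f i) with rfl | hj
  · rw [Function.update_self]
    simp only [pushVec]
    rw [← Finset.prod_erase_mul _ _
      (show i ∈ Finset.univ.filter (fun l => f l = f i) by simp), Function.update_self]
    congr 1
    refine Finset.prod_congr rfl fun l hl => ?_
    rw [Function.update_of_ne (Finset.ne_of_mem_erase hl)]
  · rw [Function.update_of_ne hj]
    change ∏ i with f i = j, _ = ∏ i with f i = j, _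
    refine Finset.prod_congr rfl fun l hl => ?_
    rw [Function.update_of_ne]
    rintro rfl
    exact hj (Finset.mem_filter.1 hl).2.symm

/-- The map `f_⋆ : I^{⊗ x} → I^{⊗ y}` induced by a surjection `f : x → y`, which permutes and
multiplies the tensor factors: the `j`-th factor of the image of `a_1 ⊗ ⋯ ⊗ a_x` is the product
of the `a_i` with `f i = j`. -/
noncomputable def pushTensor {x y : ℕ} (f : Fin x → Fin y) (hf : Function.Surjective f) :
    TPow k I x →ₗ[k] TPow k I y :=
  PiTensorProduct.lift
    { toFun := fun a => PiTensorProduct.tprod k (pushVec f hf a)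
      map_update_add' := fun {inst} a i b c => by
        obtain rfl : inst = instDecidableEqFin x := Subsingleton.elim _ _
        simp only [pushVec_update]
        rw [← MultilinearMap.map_update_add]
        congr 2
        exact Subtype.ext (mul_add _ _ _)
      map_update_smul' := fun {inst} a i r b => by
        obtain rfl : inst = instDecidableEqFin x := Subsingleton.elim _ _
        simp only [pushVec_update]
        rw [← MultilinearMap.map_update_smul]
        congr 2
        exact Subtype.ext (mul_smul_comm _ _ _) }

theorem pushTensor_tprod {x y : ℕ} (f : Fin x → Fin y) (hf : Function.Surjective f)
    (a : Fin x → I) : pushTensor k I f hf (PiTensorProduct.tprod k a) =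
      PiTensorProduct.tprod k (pushVec f hf a) := by
  rw [pushTensor, PiTensorProduct.lift.tprod]
  rfl

variable {I} in
/-- Multiplying the entries of `pushVec f a` over `S` is multiplying those of `a` over `f⁻¹ S`. -/
theorem prod_pushVec {x y : ℕ} (f : Fin x → Fin y) (hf : Function.Surjective f) (a : Fin x → I)
    (S : Finset (Fin y)) :
    ∏ j ∈ S, (pushVec f hf a j : A) = ∏ i with f i ∈ S, (a i : A) := by
  rw [← Finset.prod_fiberwise_of_maps_to (t := S) (g := f) (by simp)]
  refine Finset.prod_congr rfl fun j hj => ?_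
  simp only [pushVec]
  refine Finset.prod_congr ?_ fun _ _ => rfl
  ext i
  simp only [Finset.mem_filter, Finset.mem_univ, true_and]
  exact ⟨fun h => ⟨h ▸ hj, h⟩, fun h => h.2⟩

variable {I} in
theorem pushVec_comp {x y z : ℕ} (f : Fin x → Fin y) (hf : Function.Surjective f)
    (g : Fin y → Fin z) (hg : Function.Surjective g) (a : Fin x → I) :
    pushVec g hg (pushVec f hf a) = pushVec (g ∘ f) (hg.comp hf) a := by
  funext j
  apply Subtype.ext
  change ∏ i with g i = j, (pushVec f hf a i : A) = _
  rw [prod_pushVec]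
  simp [pushVec]

variable {I} in
theorem pushVec_congr {x y : ℕ} {f g : Fin x → Fin y} (hf : Function.Surjective f)
    (hg : Function.Surjective g) (h : f = g) (a : Fin x → I) :
    pushVec f hf a = pushVec g hg a := by
  subst h
  rfl

variable {I} in
theorem pushVec_id {x : ℕ} (f : Fin x → Fin x) (hf : Function.Surjective f) (h : f = id)
    (a : Fin x → I) : pushVec f hf a = a := by
  subst h
  funext j
  apply Subtype.ext
  simp [pushVec, Finset.filter_eq']

variable {I} in
theorem pushVec_perm {x y : ℕ} (φ : Fin x → Fin y) (g : Equiv.Perm (Fin x))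
    (h : Function.Surjective (fun i => φ (g i))) (hφ : Function.Surjective φ)
    (a : Fin x → I) : pushVec φ hφ (fun i => a (g.symm i)) = pushVec (fun i => φ (g i)) h a := by
  funext j
  apply Subtype.ext
  change ∏ i with φ i = j, (a (g.symm i) : A) = ∏ i with φ (g i) = j, (a i : A)
  refine Finset.prod_bij' (fun i _ => g.symm i) (fun i _ => g i) ?_ ?_ ?_ ?_ ?_ <;> simp

variable {I} in
theorem pushVec_restrict {x x' y y' : ℕ} (f : Fin x → Fin y) (hf : Function.Surjective f)
    (g : Fin x' → Fin y') (hg : Function.Surjective g) (ι : Fin x → Fin x') (κ : Fin y → Fin y')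
    (hι : Function.Injective ι) (hκ : Function.Injective κ) (h : ∀ q, κ (f q) = g (ι q))
    (hs : ∀ r l, g r = κ l → ∃ q, ι q = r) (c : Fin x' → I) (l : Fin y) :
    pushVec f hf (fun q => c (ι q)) l = pushVec g hg c (κ l) := by
  apply Subtype.ext
  rw [pushVec_coe, pushVec_coe]
  refine Finset.prod_nbij ι (fun q hq => ?_) (fun q _ q' _ h => hι h) (fun r hr => ?_)
    (fun q _ => rfl)
  · simp only [Finset.mem_filter, Finset.mem_univ, true_and] at hq ⊢
    rw [← h, hq]
  · simp only [Finset.coe_filter, Finset.mem_univ, true_and, Set.mem_ofPred_eq] at hr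
    obtain ⟨q, rfl⟩ := hs r l hr
    refine ⟨q, ?_, rfl⟩
    simp only [Finset.coe_filter, Finset.mem_univ, true_and, Set.mem_ofPred_eq]
    exact hκ ((h q).trans hr)

variable {I} in
theorem prod_pushVec_restrict {x x' y y' : ℕ} (f : Fin x → Fin y) (hf : Function.Surjective f)
    (g : Fin x' → Fin y') (hg : Function.Surjective g) (ι : Fin x → Fin x')
    (hι : Function.Injective ι) {S : Finset (Fin y)} {S' : Finset (Fin y')} {R : Finset (Fin x')}
    (hS : ∀ q, f q ∈ S ↔ g (ι q) ∈ S') (hR : ∀ r, r ∈ R ↔ ¬ ∃ q, ι q = r)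
    (hR' : ∀ r ∈ R, g r ∈ S') (c : Fin x' → I) :
    (∏ j ∈ S, (pushVec f hf (fun q => c (ι q)) j : A)) * ∏ j ∈ R, (c j : A) =
      ∏ j ∈ S', (pushVec g hg c j : A) := by
  rw [prod_pushVec, prod_pushVec, ← Finset.prod_filter_mul_prod_filter_not
    (Finset.univ.filter fun r => g r ∈ S') (fun r => ∃ q, ι q = r)]
  congr 1
  · refine Finset.prod_nbij ι (fun q hq => ?_) (fun q _ q' _ h => hι h) (fun r hr => ?_)
      (fun q _ => rfl)
    · simp only [Finset.mem_filter, Finset.mem_univ, true_and] at hq ⊢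
      exact ⟨(hS q).1 hq, q, rfl⟩
    · simp only [Finset.coe_filter, Finset.mem_filter, Finset.mem_univ, true_and,
        Set.mem_ofPred_eq] at hr
      obtain ⟨hr, q, rfl⟩ := hr
      refine ⟨q, ?_, rfl⟩
      simpa using (hS q).2 hr
  · refine Finset.prod_congr ?_ fun _ _ => rfl
    ext r
    simp only [Finset.mem_filter, Finset.mem_univ, true_and, hR]
    exact ⟨fun h => ⟨hR' r ((hR r).2 h), h⟩, fun h => h.2⟩

theorem EpiDeltaS.surjective_φ {a b : EpiDeltaS} (f : a ⟶ b) :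
    Function.Surjective (DeltaS.Hom.φ f.hom) := fun j => by
  obtain ⟨i, hi⟩ := EpiDeltaS.surjective f j
  exact ⟨_, hi⟩

/-- The action of `B_I^sym` on the morphism `(φ, g)`: permute the factors by `g`, then multiply
along `φ`. -/
noncomputable def symBarMap {a b : EpiDeltaS} (f : a ⟶ b) :
    TPow k I a.obj.card →ₗ[k] TPow k I b.obj.card :=
  pushTensor k I (DeltaS.Hom.φ f.hom) (EpiDeltaS.surjective_φ f) ∘ₗ
    (PiTensorProduct.reindex k (fun _ : Fin a.obj.card => (I : Type v))
      (DeltaS.Hom.g f.hom)).toLinearMap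

theorem symBarMap_tprod {a b : EpiDeltaS} (f : a ⟶ b) (y : Fin a.obj.card → I) :
    symBarMap k I f (PiTensorProduct.tprod k y) =
      PiTensorProduct.tprod k (pushVec (DeltaS.Hom.toFun f.hom) (EpiDeltaS.surjective f) y) := by
  have h := pushVec_perm (DeltaS.Hom.φ f.hom) (DeltaS.Hom.g f.hom) (EpiDeltaS.surjective f)
    (EpiDeltaS.surjective_φ f) y
  refine Eq.trans ?_ (congrArg (PiTensorProduct.tprod k) h)
  rw [symBarMap, LinearMap.comp_apply, LinearEquiv.coe_coe, PiTensorProduct.reindex_tprod,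
    pushTensor_tprod]

/-- The functor `B_I^sym : Epi ΔS ⥤ k-Mod`, for an ideal `I` of a commutative `k`-algebra: it sends
`n` to `I^{⊗ n}` and `(φ, g)` to the map
`a_1 ⊗ ⋯ ⊗ a_n ↦ ⨂_j ∏_{i ∈ φ⁻¹(j)} a_{g⁻¹(i)}`. (As the algebra is commutative, the order of the
factors in the products is immaterial.) -/
noncomputable def symBar : EpiDeltaS ⥤ ModuleCat.{max u v} k where
  obj a := ModuleCat.of k (TPow k I a.obj.card)
  map f := ModuleCat.ofHom (symBarMap k I f)
  map_id a := by
    refine ModuleCat.hom_ext (PiTensorProduct.ext (MultilinearMap.ext fun y => ?_))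
    refine (symBarMap_tprod k I (𝟙 a) y).trans ?_
    exact congrArg (PiTensorProduct.tprod k) (pushVec_id _ _ rfl y)
  map_comp {a b c} f f' := by
    refine ModuleCat.hom_ext (PiTensorProduct.ext (MultilinearMap.ext fun y => ?_))
    refine (symBarMap_tprod k I (f ≫ f') y).trans ?_
    refine Eq.trans ?_ (congrArg (symBarMap k I f') (symBarMap_tprod k I f y)).symm
    refine Eq.trans ?_ (symBarMap_tprod k I f' _).symm
    rw [pushVec_comp]
    congr 1
    have := DeltaS.toFun_comp f.hom f'.hom
    congr 1

variable (M : Type w) [AddCommGroup M] [Module k M] [Module A M] [IsScalarTower k A M]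

variable {I} in
theorem update_orderEmb_mem {y : ℕ} {T : Finset (Fin y)} {i : Fin y} (hi : i ∈ T) :
    ∃ l₀, ∀ (a : Fin y → I) (b : I), (fun l => Function.update a i b (T.orderEmbOfFin rfl l)) =
      Function.update (fun l => a (T.orderEmbOfFin rfl l)) l₀ b := by
  obtain ⟨l₀, rfl⟩ : i ∈ Set.range (T.orderEmbOfFin rfl) := by
    rw [Finset.range_orderEmbOfFin]; exact hi
  exact ⟨l₀, fun a b => Function.update_comp_eq_of_injective a (T.orderEmbOfFin rfl).injective l₀ b⟩

variable {I} in
theorem update_orderEmb_notMem {y : ℕ} {T : Finset (Fin y)} {i : Fin y} (hi : i ∉ T)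
    (a : Fin y → I) (b : I) : (fun l => Function.update a i b (T.orderEmbOfFin rfl l)) =
      (fun l => a (T.orderEmbOfFin rfl l)) := by
  funext l
  rw [Function.update_of_ne]
  rintro rfl
  exact hi (T.orderEmbOfFin_mem rfl l)

variable {I} in
theorem prod_update_notMem {y : ℕ} {S : Finset (Fin y)} {i : Fin y} (hi : i ∉ S)
    (a : Fin y → I) (b : I) :
    ∏ j ∈ S, (Function.update a i b j : A) = ∏ j ∈ S, (a j : A) := by
  refine Finset.prod_congr rfl fun j hj => ?_
  rw [Function.update_of_ne]
  rintro rfl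
  exact hi hj

variable {I} in
theorem prod_update_mem {y : ℕ} {S : Finset (Fin y)} {i : Fin y} (hi : i ∈ S)
    (a : Fin y → I) (b : I) :
    ∏ j ∈ S, (Function.update a i b j : A) = (∏ j ∈ S.erase i, (a j : A)) * b := by
  rw [← Finset.prod_erase_mul _ _ hi, Function.update_self,
    prod_update_notMem (Finset.notMem_erase i S)]

open TensorProduct in
/-- For `T ⊆ {1, …, y}`, the map `I^{⊗ y} ⊗ M → I^{⊗ |T|} ⊗ M` which keeps the tensor factors
indexed by `T` in their order and lets all others act on `M`. -/
noncomputable def restrictTensor {y : ℕ} (T : Finset (Fin y)) :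
    (TPow k I y ⊗[k] M) →ₗ[k] (TPow k I T.card ⊗[k] M) :=
  TensorProduct.lift <| PiTensorProduct.lift
    { toFun := fun a => TensorProduct.mk k (TPow k I T.card) M
        (PiTensorProduct.tprod k fun l => a (T.orderEmbOfFin rfl l)) ∘ₗ
          Algebra.lsmul k k M (∏ j ∈ Tᶜ, (a j : A))
      map_update_add' := fun {inst} a i b c => by
        obtain rfl : inst = instDecidableEqFin y := Subsingleton.elim _ _
        refine LinearMap.ext fun μ => ?_
        by_cases hi : i ∈ T
        · obtain ⟨l₀, hl⟩ := update_orderEmb_mem (I := I) hi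
          have hi' : i ∉ Tᶜ := by simpa using hi
          simp only [LinearMap.add_apply, LinearMap.comp_apply, TensorProduct.mk_apply, hl,
            prod_update_notMem hi', MultilinearMap.map_update_add, TensorProduct.add_tmul]
        · have hi' : i ∈ Tᶜ := by simpa using hi
          simp only [LinearMap.add_apply, LinearMap.comp_apply, TensorProduct.mk_apply,
            update_orderEmb_notMem hi, prod_update_mem hi', ← TensorProduct.tmul_add]
          congr 1
          simp only [Algebra.lsmul_coe, Submodule.coe_add, mul_add, add_smul]
      map_update_smul' := fun {inst} a i r b => by
        obtain rfl : inst = instDecidableEqFin y := Subsingleton.elim _ _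
        refine LinearMap.ext fun μ => ?_
        by_cases hi : i ∈ T
        · obtain ⟨l₀, hl⟩ := update_orderEmb_mem (I := I) hi
          have hi' : i ∉ Tᶜ := by simpa using hi
          simp only [LinearMap.smul_apply, LinearMap.comp_apply, TensorProduct.mk_apply, hl,
            prod_update_notMem hi', MultilinearMap.map_update_smul, TensorProduct.smul_tmul']
        · have hi' : i ∈ Tᶜ := by simpa using hi
          simp only [LinearMap.smul_apply, LinearMap.comp_apply, TensorProduct.mk_apply,
            update_orderEmb_notMem hi, prod_update_mem hi', ← TensorProduct.tmul_smul]
          congr 1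
          simp only [Algebra.lsmul_coe, Submodule.coe_smul_of_tower, mul_smul_comm, smul_assoc] }

open TensorProduct in
theorem restrictTensor_tmul {y : ℕ} (T : Finset (Fin y)) (a : Fin y → I) (μ : M) :
    restrictTensor k I M T (PiTensorProduct.tprod k a ⊗ₜ μ) =
      (PiTensorProduct.tprod k fun l => a (T.orderEmbOfFin rfl l)) ⊗ₜ
        ((∏ j ∈ Tᶜ, (a j : A)) • μ) := by
  rw [restrictTensor, TensorProduct.lift.tmul, PiTensorProduct.lift.tprod]
  rfl

end Tensor

/-! ### The Robinson–Whitehouse complex -/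

section Strings

/-- The surjection from the `j`-th to the `l`-th set of a string in `Ω`. -/
abbrev strMap {n : ℕ} (s : ComposableArrows Omega n) {j l : Fin (n + 1)} (h : j ≤ l) :
    Fin (s.obj j).card → Fin (s.obj l).card :=
  (s.map (homOfLE h)).1

theorem strMap_surjective {n : ℕ} (s : ComposableArrows Omega n) {j l : Fin (n + 1)} (h : j ≤ l) :
    Function.Surjective (strMap s h) :=
  (s.map (homOfLE h)).2

theorem strMap_refl {n : ℕ} (s : ComposableArrows Omega n) {j : Fin (n + 1)} (h : j ≤ j) :
    strMap s h = id :=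
  congrArg Subtype.val (s.map_id j)

theorem strMap_strMap {n : ℕ} (s : ComposableArrows Omega n) {j l m : Fin (n + 1)} (h : j ≤ l)
    (h' : l ≤ m) (a : Fin (s.obj j).card) :
    strMap s h' (strMap s h a) = strMap s (h.trans h') a :=
  (congrFun (congrArg Subtype.val (s.map_comp (homOfLE h) (homOfLE h'))) a).symm

/-- The preimage in the `j`-th set of the string `s` of an element `i` of the final codomain. -/
def fibre {n : ℕ} (s : ComposableArrows Omega n) (i : Fin (s.obj (Fin.last n)).card)
    (j : Fin (n + 1)) : Finset (Fin (s.obj j).card) :=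
  {a | strMap s (Fin.le_last j) a = i}

theorem mem_fibre {n : ℕ} {s : ComposableArrows Omega n} {i : Fin (s.obj (Fin.last n)).card}
    {j : Fin (n + 1)} {a : Fin (s.obj j).card} :
    a ∈ fibre s i j ↔ strMap s (Fin.le_last j) a = i := by
  simp [fibre]

/-- The order-preserving enumeration of `fibre s i j`. -/
abbrev fibreEmb {n : ℕ} (s : ComposableArrows Omega n) (i : Fin (s.obj (Fin.last n)).card)
    (j : Fin (n + 1)) : Fin (fibre s i j).card ↪o Fin (s.obj j).card :=
  (fibre s i j).orderEmbOfFin rfl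

theorem strMap_fibreEmb_mem {n : ℕ} (s : ComposableArrows Omega n)
    (i : Fin (s.obj (Fin.last n)).card) {j l : Fin (n + 1)} (h : j ≤ l)
    (a : Fin (fibre s i j).card) : strMap s h (fibreEmb s i j a) ∈ fibre s i l := by
  rw [mem_fibre, strMap_strMap]
  exact mem_fibre.1 (Finset.orderEmbOfFin_mem _ _ a)

/-- The restriction of the maps in the string `s` to the preimages of `i`, re-indexed by the
order-preserving enumerations. -/
def compMap {n : ℕ} (s : ComposableArrows Omega n) (i : Fin (s.obj (Fin.last n)).card)
    {j l : Fin (n + 1)} (h : j ≤ l) (a : Fin (fibre s i j).card) : Fin (fibre s i l).card :=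
  ((fibre s i l).orderIsoOfFin rfl).symm
    ⟨strMap s h (fibreEmb s i j a), strMap_fibreEmb_mem s i h a⟩

theorem fibreEmb_compMap {n : ℕ} (s : ComposableArrows Omega n)
    (i : Fin (s.obj (Fin.last n)).card) {j l : Fin (n + 1)} (h : j ≤ l)
    (a : Fin (fibre s i j).card) :
    fibreEmb s i l (compMap s i h a) = strMap s h (fibreEmb s i j a) := by
  rw [fibreEmb, ← Finset.coe_orderIsoOfFin_apply, compMap, OrderIso.apply_symm_apply]

theorem exists_fibreEmb {n : ℕ} {s : ComposableArrows Omega n}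
    {i : Fin (s.obj (Fin.last n)).card} {j : Fin (n + 1)} {a : Fin (s.obj j).card}
    (h : strMap s (Fin.le_last j) a = i) : ∃ b, fibreEmb s i j b = a := by
  have : a ∈ Set.range (fibreEmb s i j) := by
    rw [Finset.range_orderEmbOfFin]
    exact mem_fibre.2 h
  exact this

theorem strMap_fibreEmb {n : ℕ} (s : ComposableArrows Omega n)
    (i : Fin (s.obj (Fin.last n)).card) (j : Fin (n + 1)) (a : Fin (fibre s i j).card) :
    strMap s (Fin.le_last j) (fibreEmb s i j a) = i :=
  mem_fibre.1 (Finset.orderEmbOfFin_mem _ _ a)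

/-- The component of a string `s` in `Ω` at an element `i` of its final codomain: the
string of the preimages of `i`, re-indexed in the order-preserving way. Its final codomain is a
one-element set. -/
def component {n : ℕ} (s : ComposableArrows Omega n) (i : Fin (s.obj (Fin.last n)).card) :
    ComposableArrows Omega n where
  obj j := ⟨(fibre s i j).card, by
    obtain ⟨a, ha⟩ := strMap_surjective s (Fin.le_last j) i
    exact Finset.card_pos.2 ⟨a, mem_fibre.2 ha⟩⟩
  map {j l} f := ⟨compMap s i (leOfHom f), fun b => by
    obtain ⟨a, ha⟩ := strMap_surjective s (leOfHom f) (fibreEmb s i l b)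
    obtain ⟨a', rfl⟩ : ∃ a', fibreEmb s i j a' = a := exists_fibreEmb (by
      rw [← strMap_strMap s (leOfHom f) (Fin.le_last l), ha]
      exact strMap_fibreEmb s i l b)
    refine ⟨a', (fibreEmb s i l).injective ?_⟩
    rw [fibreEmb_compMap, ha]⟩
  map_id j := Subtype.ext <| funext fun a => (fibreEmb s i j).injective <| by
    refine (fibreEmb_compMap s i _ a).trans ?_
    rw [strMap_refl]
    rfl
  map_comp {j l m} f g := Subtype.ext <| funext fun a => (fibreEmb s i m).injective <| by
    refine (fibreEmb_compMap s i _ a).trans (Eq.symm ?_)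
    refine (fibreEmb_compMap s i (leOfHom g) (compMap s i (leOfHom f) a)).trans ?_
    rw [fibreEmb_compMap, strMap_strMap]

theorem component_last {n : ℕ} (s : ComposableArrows Omega n)
    (i : Fin (s.obj (Fin.last n)).card) : ((component s i).obj (Fin.last n)).card = 1 := by
  refine (Finset.card_eq_one (s := fibre s i (Fin.last n))).2 ⟨i, ?_⟩
  ext a
  rw [mem_fibre, strMap_refl]
  simp

/-- The strings of `n` composable morphisms in `Ω` with final codomain the one-element set. -/
abbrev OneString (n : ℕ) : Type :=
  {s : ComposableArrows Omega n // (s.obj (Fin.last n)).card = 1}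

end Strings

section RobinsonWhitehouse

open TensorProduct

variable (k : Type u) [CommRing k] {A : Type v} [CommRing A] [Algebra k A] (I : Ideal A)
variable (M : Type w) [AddCommGroup M] [Module k M]

/-- The module `C Γ_n(I, M)`: the direct sum of the modules `I^{⊗ x} ⊗ M` over the strings of length
`n` in `Ω` with initial domain `x` (any `x ≥ 1`) and final codomain the one-element set. -/
abbrev RWModule (n : ℕ) : Type (max u v w) :=
  DirectSum (OneString n) fun s => TPow k I (s.1.obj 0).card ⊗[k] M

noncomputable instance (n : ℕ) : AddCommGroup (RWModule k I M n) :=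
  Module.addCommMonoidToAddCommGroup k

open Classical in
/-- The inclusion of the summand of `C Γ_n(I, M)` indexed by the string `s`. -/
noncomputable abbrev rwIncl (n : ℕ) (s : OneString n) :
    (TPow k I (s.1.obj 0).card ⊗[k] M) →ₗ[k] RWModule k I M n :=
  DirectSum.lof k (OneString n) (fun s => TPow k I (s.1.obj 0).card ⊗[k] M) s

variable {k I M} in
theorem rwModule_hom_ext {n : ℕ} {P : Type*} [AddCommMonoid P] [Module k P]
    {f g : RWModule k I M n →ₗ[k] P}
    (h : ∀ (s : OneString n) (a : Fin (s.1.obj 0).card → I) (μ : M),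
      f (rwIncl k I M n s (PiTensorProduct.tprod k a ⊗ₜ μ)) =
        g (rwIncl k I M n s (PiTensorProduct.tprod k a ⊗ₜ μ))) : f = g := by
  classical
  refine DirectSum.linearMap_ext _ fun s => TensorProduct.ext (PiTensorProduct.ext
    (MultilinearMap.ext fun a => LinearMap.ext fun μ => ?_))
  exact h s a μ

/-- Two generators agree if their strings have a common order-preserving enumeration. -/
theorem rwIncl_ext {n : ℕ} (t t' : OneString n) (X : Fin (n + 1) → ℕ)
    (m : ∀ {j l : Fin (n + 1)}, j ≤ l → Fin (X j) → Fin (X l))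
    (e : ∀ j, Fin (t.1.obj j).card ↪o Fin (X j)) (e' : ∀ j, Fin (t'.1.obj j).card ↪o Fin (X j))
    (hr : ∀ j x, (∃ y, e j y = x) ↔ ∃ y, e' j y = x)
    (he : ∀ {j l : Fin (n + 1)} (h : j ≤ l) y, e l (strMap t.1 h y) = m h (e j y))
    (he' : ∀ {j l : Fin (n + 1)} (h : j ≤ l) y, e' l (strMap t'.1 h y) = m h (e' j y))
    (b : Fin (X 0) → I) (c : Fin (t.1.obj 0).card → I) (c' : Fin (t'.1.obj 0).card → I)
    (hc : ∀ l, c l = b (e 0 l)) (hc' : ∀ l, c' l = b (e' 0 l)) (μ μ' : M) (hμ : μ = μ') :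
    rwIncl k I M n t (PiTensorProduct.tprod k c ⊗ₜ[k] μ) =
      rwIncl k I M n t' (PiTensorProduct.tprod k c' ⊗ₜ[k] μ') := by
  subst hμ
  obtain ⟨⟨obj, map, h1, h2⟩, h3⟩ := t
  obtain ⟨⟨obj', map', h1', h2'⟩, h3'⟩ := t'
  have hset : ∀ j, Set.range (e j) = Set.range (e' j) := fun j => Set.ext (hr j)
  obtain rfl : obj = obj' := by
    funext j
    apply Omega.ext
    have := congrArg Set.ncard (hset j)
    rw [← Set.image_univ, ← Set.image_univ, Set.ncard_image_of_injective _ (e j).injective,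
      Set.ncard_image_of_injective _ (e' j).injective, Set.ncard_univ, Set.ncard_univ] at this
    simpa using this
  have hee : ∀ j y, e j y = e' j y := fun j y =>
    congrFun ((StrictMono.range_inj (e j).strictMono (e' j).strictMono).1 (hset j)) y
  obtain rfl : @map = @map' := by
    funext j l f
    apply Subtype.ext
    funext y
    apply (e l).injective
    refine (he (leOfHom f) y).trans ?_
    rw [hee j y]
    refine (he' (leOfHom f) y).symm.trans ?_
    exact (hee l _).symm
  obtain rfl : c = c' := by
    funext l
    rw [hc, hc', hee]
  rfl

variable [Module A M] [IsScalarTower k A M]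

/-- For an element `i` of the final codomain of `s`, the map which keeps the tensor
factors in the preimage of `i`, and lets all others act on `M`. -/
noncomputable def componentTensor {n : ℕ} (s : ComposableArrows Omega n)
    (i : Fin (s.obj (Fin.last n)).card) :
    (TPow k I (s.obj 0).card ⊗[k] M) →ₗ[k] (TPow k I ((component s i).obj 0).card ⊗[k] M) :=
  restrictTensor k I M (fibre s i 0)

theorem componentTensor_tmul {n : ℕ} (s : ComposableArrows Omega n)
    (i : Fin (s.obj (Fin.last n)).card) (a : Fin (s.obj 0).card → I) (μ : M) :
    componentTensor k I M s i (PiTensorProduct.tprod k a ⊗ₜ μ) =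
      (PiTensorProduct.tprod k fun l => a (fibreEmb s i 0 l)) ⊗ₜ
        ((∏ j ∈ (fibre s i 0)ᶜ, (a j : A)) • μ) :=
  restrictTensor_tmul k I M _ a μ

open Classical in
/-- The map of `C Γ_*(I, M)` induced by a map `θ` of the simplex category. On the summand of a
string `s` it sends `[s] ⊗ a ⊗ μ` to the sum over the elements `i` of the final codomain
of `θ^* s` of `[component (θ^* s) i] ⊗ a_i ⊗ μ_i`. Here `a_i ⊗ μ_i` is obtained from
`a ⊗ μ` by first pushing `a` forward to the initial domain of `θ^* s` and then letting all factors
outside the preimage of `i` act on `μ`. -/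
noncomputable def rwMap {x y : SimplexCategory} (θ : y ⟶ x) :
    RWModule k I M x.len →ₗ[k] RWModule k I M y.len :=
  DirectSum.toModule k _ _ fun s =>
    ∑ i : Fin ((pullString θ s.1).obj (Fin.last y.len)).card,
      rwIncl k I M y.len ⟨component (pullString θ s.1) i, component_last _ i⟩ ∘ₗ
        componentTensor k I M (pullString θ s.1) i ∘ₗ
          (pushTensor k I (initialMap θ s.1).1 (initialMap θ s.1).2).rTensor M

theorem rwMap_incl {x y : SimplexCategory} (θ : y ⟶ x) (s : OneString x.len)
    (a : Fin (s.1.obj 0).card → I) (μ : M) :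
    rwMap k I M θ (rwIncl k I M x.len s (PiTensorProduct.tprod k a ⊗ₜ μ)) =
      ∑ i : Fin ((pullString θ s.1).obj (Fin.last y.len)).card,
        rwIncl k I M y.len ⟨component (pullString θ s.1) i, component_last _ i⟩
          ((PiTensorProduct.tprod k fun l =>
            pushVec (initialMap θ s.1).1 (initialMap θ s.1).2 a
              (fibreEmb (pullString θ s.1) i 0 l)) ⊗ₜ[k]
            ((∏ j ∈ (fibre (pullString θ s.1) i 0)ᶜ,
              (pushVec (initialMap θ s.1).1 (initialMap θ s.1).2 a j : A)) • μ)) := by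
  rw [rwMap, DirectSum.toModule_lof, LinearMap.sum_apply]
  refine Finset.sum_congr rfl fun i _ => ?_
  rw [LinearMap.comp_apply, LinearMap.comp_apply, LinearMap.rTensor_tmul, pushTensor_tprod,
    componentTensor_tmul]
  rfl

/-- The summand at `p` of the map induced by a map of the simplex category. -/
noncomputable def rwTerm {n : ℕ} (S : ComposableArrows Omega n)
    (p : Fin (S.obj (Fin.last n)).card) (c : Fin (S.obj 0).card → I) (μ : M) : RWModule k I M n :=
  rwIncl k I M n ⟨component S p, component_last S p⟩
    ((PiTensorProduct.tprod k fun l => c (fibreEmb S p 0 l)) ⊗ₜ[k]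
      ((∏ j ∈ (fibre S p 0)ᶜ, (c j : A)) • μ))

theorem sum_rwTerm_of_card_eq_one {n : ℕ} (S : OneString n) (c : Fin (S.1.obj 0).card → I) (μ : M) :
    ∑ i : Fin (S.1.obj (Fin.last n)).card, rwTerm k I M S.1 i c μ =
      rwIncl k I M n S (PiTensorProduct.tprod k c ⊗ₜ[k] μ) := by
  have hs : Subsingleton (Fin (S.1.obj (Fin.last n)).card) := by
    rw [S.2]; infer_instance
  have hT : ∀ i, (fibre S.1 i 0)ᶜ = ∅ := fun i => by
    rw [Finset.compl_eq_empty_iff, Finset.eq_univ_iff_forall]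
    exact fun z => mem_fibre.2 (Subsingleton.elim _ _)
  let i₀ : Fin (S.1.obj (Fin.last n)).card := ⟨0, (S.1.obj _).pos⟩
  refine (Finset.sum_eq_single i₀ (fun b _ hb => absurd (hs.elim _ _) hb)
    (fun h => absurd (Finset.mem_univ _) h)).trans ?_
  have h1 : ∀ j z, (∃ q, fibreEmb S.1 i₀ j q = z) ↔
      ∃ q, RelEmbedding.refl (fun a b : Fin (S.1.obj j).card => a ≤ b) q = z :=
    fun j z => ⟨fun _ => ⟨z, rfl⟩, fun _ => exists_fibreEmb (hs.elim _ _)⟩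
  have h2 : (∏ j ∈ (fibre S.1 i₀ 0)ᶜ, (c j : A)) • μ = μ := by
    rw [hT, Finset.prod_empty, one_smul]
  exact rwIncl_ext k I M ⟨component S.1 i₀, component_last S.1 i₀⟩ S
    (fun j => (S.1.obj j).card) (fun h => strMap S.1 h) (fun j => fibreEmb S.1 i₀ j)
    (fun j => RelEmbedding.refl _) h1 (fun h y => fibreEmb_compMap S.1 i₀ h y)
    (fun h y => rfl) c _ c (fun l => rfl) (fun l => rfl) _ μ h2

/-- If `θ^* s` still ends in the one-element set (as for the faces other than the last one, and for
the degeneracies), then `θ` sends `[s] ⊗ a ⊗ μ` to `[θ^* s] ⊗ a' ⊗ μ`, where `a'` is `a` pushed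
forward to the initial domain of `θ^* s`. -/
theorem rwMap_incl_of_card_eq_one {x y : SimplexCategory} (θ : y ⟶ x) (s : OneString x.len)
    (h : ((pullString θ s.1).obj (Fin.last y.len)).card = 1)
    (a : Fin (s.1.obj 0).card → I) (μ : M) :
    rwMap k I M θ (rwIncl k I M x.len s (PiTensorProduct.tprod k a ⊗ₜ μ)) =
      rwIncl k I M y.len ⟨pullString θ s.1, h⟩
        (PiTensorProduct.tprod k (pushVec (initialMap θ s.1).1 (initialMap θ s.1).2 a) ⊗ₜ[k]
          μ) := by
  rw [rwMap_incl]
  exact sum_rwTerm_of_card_eq_one k I M ⟨pullString θ s.1, h⟩ _ μ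

theorem rwMap_id (x : SimplexCategory) : rwMap k I M (𝟙 x) = LinearMap.id := by
  refine rwModule_hom_ext fun s a μ => ?_
  refine (rwMap_incl_of_card_eq_one k I M (𝟙 x) s s.2 a μ).trans ?_
  have hp : pushVec (initialMap (𝟙 x) s.1).1 (initialMap (𝟙 x) s.1).2 a = a :=
    pushVec_id _ _ (strMap_refl s.1 (le_refl 0)) a
  exact congrArg (fun c => rwIncl k I M x.len s (PiTensorProduct.tprod k c ⊗ₜ[k] μ)) hp

/-- The element of the final codomain of `η^* T` that corresponds to an element of the
final codomain of `η^*` of the component of `T` at `i`. -/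
def lastEmb {y z : SimplexCategory} (η : z ⟶ y) (T : ComposableArrows Omega y.len)
    (i : Fin (T.obj (Fin.last y.len)).card)
    (i' : Fin ((pullString η (component T i)).obj (Fin.last z.len)).card) :
    Fin ((pullString η T).obj (Fin.last z.len)).card :=
  fibreEmb T i (η.toOrderHom (Fin.last z.len)) i'

theorem lastEmb_bijective {y z : SimplexCategory} (η : z ⟶ y) (T : ComposableArrows Omega y.len) :
    Function.Bijective fun q : Σ i : Fin (T.obj (Fin.last y.len)).card,
      Fin ((pullString η (component T i)).obj (Fin.last z.len)).card => lastEmb η T q.1 q.2 := by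
  constructor
  · rintro ⟨i, i'⟩ ⟨j, j'⟩ h
    have h1 := strMap_fibreEmb T i (η.toOrderHom (Fin.last z.len)) i'
    have h2 := strMap_fibreEmb T j (η.toOrderHom (Fin.last z.len)) j'
    obtain rfl : i = j := by
      rw [← h1, ← h2]
      exact congrArg _ h
    congr 1
    exact (fibreEmb T i _).injective h
  · intro p
    obtain ⟨q, hq⟩ := exists_fibreEmb (s := T) (j := η.toOrderHom (Fin.last z.len)) (a := p) rfl
    exact ⟨⟨_, q⟩, hq⟩

theorem rwTerm_component {y z : SimplexCategory} (η : z ⟶ y) (T : ComposableArrows Omega y.len)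
    (i : Fin (T.obj (Fin.last y.len)).card)
    (i' : Fin ((pullString η (component T i)).obj (Fin.last z.len)).card)
    (c : Fin (T.obj 0).card → I) (μ : M) :
    rwTerm k I M (pullString η (component T i)) i'
      (pushVec (initialMap η (component T i)).1 (initialMap η (component T i)).2
        fun l => c (fibreEmb T i 0 l)) ((∏ j ∈ (fibre T i 0)ᶜ, (c j : A)) • μ) =
    rwTerm k I M (pullString η T) (lastEmb η T i i')
      (pushVec (initialMap η T).1 (initialMap η T).2 c) μ := by
  have hmono : ∀ {j l : Fin (z.len + 1)}, j ≤ l → η.toOrderHom j ≤ η.toOrderHom l :=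
    fun h => η.toOrderHom.monotone h
  let C := pullString η (component T i)
  let e : ∀ j, Fin ((component C i').obj j).card ↪o Fin ((pullString η T).obj j).card :=
    fun j => (fibreEmb C i' j).trans (fibreEmb T i (η.toOrderHom j))
  have hC : ∀ {j l : Fin (z.len + 1)} (h : j ≤ l) (q : Fin (C.obj j).card),
      fibreEmb T i (η.toOrderHom l) (strMap C h q) =
        strMap (pullString η T) h (fibreEmb T i (η.toOrderHom j) q) :=
    fun h q => fibreEmb_compMap T i (hmono h) q
  have h0 : ∀ q : Fin ((component T i).obj 0).card,
      fibreEmb T i (η.toOrderHom 0) ((initialMap η (component T i)).1 q) =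
        (initialMap η T).1 (fibreEmb T i 0 q) :=
    fun q => fibreEmb_compMap T i (Fin.zero_le _) q
  have hlast : ∀ {j} (x : Fin ((pullString η T).obj j).card),
      strMap (pullString η T) (Fin.le_last j) x = lastEmb η T i i' →
        strMap T (Fin.le_last (η.toOrderHom j)) x = i := by
    intro j x hx
    refine (strMap_strMap T (hmono (Fin.le_last j)) (Fin.le_last _) x).symm.trans ?_
    refine (congrArg _ hx).trans ?_
    exact strMap_fibreEmb T i _ _
  have hiff : ∀ {j} (q : Fin (C.obj j).card),
      strMap (pullString η T) (Fin.le_last j) (fibreEmb T i (η.toOrderHom j) q) =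
        lastEmb η T i i' ↔ strMap C (Fin.le_last j) q = i' := by
    intro j q
    rw [← hC]
    exact (fibreEmb T i _).injective.eq_iff
  have hpush : ∀ l : Fin (C.obj 0).card,
      pushVec (initialMap η (component T i)).1 (initialMap η (component T i)).2
        (fun l => c (fibreEmb T i 0 l)) l =
      pushVec (initialMap η T).1 (initialMap η T).2 c (fibreEmb T i (η.toOrderHom 0) l) := by
    intro l
    refine pushVec_restrict _ _ _ _ (fibreEmb T i 0) (fibreEmb T i (η.toOrderHom 0))
      (fibreEmb T i 0).injective (fibreEmb T i _).injective h0 (fun r l hr => ?_) c l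
    exact exists_fibreEmb (by
      refine (strMap_strMap T (Fin.zero_le _) (Fin.le_last (η.toOrderHom 0)) r).symm.trans ?_
      refine (congrArg _ hr).trans ?_
      exact strMap_fibreEmb T i _ _)
  have h1 : ∀ j x, (∃ q, e j q = x) ↔
      ∃ q, fibreEmb (pullString η T) (lastEmb η T i i') j q = x := by
    intro j x
    constructor
    · rintro ⟨q, rfl⟩
      exact exists_fibreEmb ((hiff _).2 (strMap_fibreEmb C i' j q))
    · rintro ⟨q, rfl⟩
      have hq := strMap_fibreEmb (pullString η T) (lastEmb η T i i') j q
      obtain ⟨y, hy⟩ := exists_fibreEmb (hlast _ hq)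
      rw [← hy] at hq
      obtain ⟨y', rfl⟩ := exists_fibreEmb ((hiff y).1 hq)
      exact ⟨y', hy⟩
  have h2 : ∀ {j l : Fin (z.len + 1)} (h : j ≤ l) q,
      e l (strMap (component C i') h q) = strMap (pullString η T) h (e j q) := by
    intro j l h q
    refine Eq.trans (congrArg (fibreEmb T i (η.toOrderHom l)) (fibreEmb_compMap C i' h q)) ?_
    exact hC h _
  have h3 : (∏ j ∈ (fibre C i' 0)ᶜ, (pushVec (initialMap η (component T i)).1
        (initialMap η (component T i)).2 (fun l => c (fibreEmb T i 0 l)) j : A)) •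
          ((∏ j ∈ (fibre T i 0)ᶜ, (c j : A)) • μ) =
      (∏ j ∈ (fibre (pullString η T) (lastEmb η T i i') 0)ᶜ,
        (pushVec (initialMap η T).1 (initialMap η T).2 c j : A)) • μ := by
    rw [smul_smul]
    congr 1
    refine prod_pushVec_restrict _ _ _ _ (fibreEmb T i 0) (fibreEmb T i 0).injective
      (fun q => ?_) (fun r => ?_) (fun r hr => ?_) c
    · rw [Finset.mem_compl, Finset.mem_compl, mem_fibre, mem_fibre]
      exact not_congr ((hiff _).symm.trans (Eq.congr_left (congrArg _ (h0 q))))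
    · rw [Finset.mem_compl, mem_fibre]
      refine not_congr ⟨exists_fibreEmb, ?_⟩
      rintro ⟨q, rfl⟩
      exact strMap_fibreEmb T i 0 q
    · rw [Finset.mem_compl, mem_fibre] at hr ⊢
      intro h
      exact hr ((strMap_strMap T (Fin.zero_le _) (Fin.le_last _) r).symm.trans (hlast _ h))
  exact rwIncl_ext k I M ⟨component C i', component_last C i'⟩
    ⟨component (pullString η T) (lastEmb η T i i'), component_last _ _⟩
    (fun j => ((pullString η T).obj j).card) (fun h => strMap (pullString η T) h) e
    (fun j => fibreEmb (pullString η T) (lastEmb η T i i') j) h1 h2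
    (fun h q => fibreEmb_compMap (pullString η T) _ h q)
    (pushVec (initialMap η T).1 (initialMap η T).2 c) _ _ (fun l => hpush _) (fun l => rfl) _ _ h3

theorem rwMap_comp {x y z : SimplexCategory} (θ : y ⟶ x) (η : z ⟶ y) :
    rwMap k I M (η ≫ θ) = rwMap k I M η ∘ₗ rwMap k I M θ := by
  refine rwModule_hom_ext fun s a μ => ?_
  rw [LinearMap.comp_apply, rwMap_incl, rwMap_incl, map_sum]
  refine Eq.trans ?_ (Finset.sum_congr rfl fun i _ => (rwMap_incl k I M η
    ⟨component (pullString θ s.1) i, component_last _ i⟩ _ _)).symm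
  rw [Finset.sum_sigma']
  symm
  refine Fintype.sum_bijective _ (lastEmb_bijective η (pullString θ s.1)) _ _ fun q => ?_
  refine (rwTerm_component k I M η (pullString θ s.1) q.1 q.2 _ μ).trans ?_
  have h : pushVec (initialMap η (pullString θ s.1)).1 (initialMap η (pullString θ s.1)).2
      (pushVec (initialMap θ s.1).1 (initialMap θ s.1).2 a) =
      pushVec (initialMap (η ≫ θ) s.1).1 (initialMap (η ≫ θ) s.1).2 a :=
    (pushVec_comp _ _ _ _ a).trans
      (pushVec_congr _ _ (funext fun v => strMap_strMap s.1 _ _ v) a)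
  exact congrArg (fun c => rwTerm k I M (pullString (η ≫ θ) s.1)
    (lastEmb η (pullString θ s.1) q.1 q.2) c μ) h

/-- The simplicial `k`-module `C Γ_*(I, M)`. On a generator `[f_n | ⋯ | f_1] ⊗ a ⊗ μ`, the `0`-th
face is `[f_n | ⋯ | f_2] ⊗ (f_1)_⋆ a ⊗ μ`, the inner faces compose adjacent morphisms, the `n`-th
face is the sum over `i ∈ x_{n-1}` of `[f_{n-1}^i | ⋯ | f_1^i] ⊗ (a_{i_1} ⊗ ⋯ ⊗ a_{i_r}) ⊗ (∏ a_j) μ`,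
where `i_1 < ⋯ < i_r` is the preimage of `i` and `j` runs over its complement, and the
degeneracies insert identities. -/
noncomputable def robinsonWhitehouse : SimplicialObject (ModuleCat.{max u v w} k) where
  obj x := ModuleCat.of k (RWModule k I M x.unop.len)
  map θ := ModuleCat.ofHom (rwMap k I M θ.unop)
  map_id x := ModuleCat.hom_ext (rwMap_id k I M x.unop)
  map_comp θ η := ModuleCat.hom_ext (rwMap_comp k I M θ.unop η.unop)



/-- The generator `[s] ⊗ y ⊗ μ` of `C Γ_n(I, M)`. -/
noncomputable def robinsonWhitehouseGen (k : Type u) [CommRing k] {A : Type v} [CommRing A]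
    [Algebra k A] (I : Ideal A) (M : Type w) [AddCommGroup M] [Module k M] [Module A M]
    [IsScalarTower k A M] {n : ℕ} (s : OneString n) (y : TPow k I (s.1.obj 0).card) (μ : M) :
    (robinsonWhitehouse k I M) _⦋n⦌ :=
  rwIncl k I M n s (y ⊗ₜ[k] μ)

end RobinsonWhitehouse

/-! ### Augmented algebras and the comparison -/

section Augmented

variable {k : Type u} [CommRing k] {A : Type v} [CommRing A] [Algebra k A] (ε : A →ₐ[k] k)

/-- The augmentation ideal of a commutative `k`-algebra `A` with augmentation `ε`. -/
abbrev augIdeal : Ideal A := RingHom.ker ε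

/-- The `k`-module `k`, regarded as a (symmetric) `A`-module through the augmentation `ε`. -/
@[nolint unusedArguments]
def AugCoeff (_ε : A →ₐ[k] k) : Type u := k

noncomputable instance : AddCommGroup (AugCoeff ε) := inferInstanceAs (AddCommGroup k)

noncomputable instance : Module k (AugCoeff ε) := inferInstanceAs (Module k k)

noncomputable instance : Module A (AugCoeff ε) := Module.compHom k ε.toRingHom

instance : IsScalarTower k A (AugCoeff ε) where
  smul_assoc c a m := by
    change ε (c • a) * (show k from m) = c * (ε a * (show k from m))
    rw [map_smul, smul_eq_mul, mul_assoc]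

/-- The normalized complex `NCS_*(I)` of the simplicial module `C_*(Epi ΔS, B_I^sym)`. -/
noncomputable def NCS : ChainComplex (ModuleCat.{max u v} k) ℕ :=
  normalizedComplex (gabrielZisman (symBar k (augIdeal ε)))

/-- The class in `NCS_n(I)` of the generator `(s, y)`, where `s` is a string of `n` composable
morphisms of `Epi ΔS` and `y ∈ I^{⊗ x}`, with `x` the initial domain of `s`. -/
noncomputable def symGen {n : ℕ} (s : ComposableArrows EpiDeltaS n)
    (y : TPow k (augIdeal ε) (s.obj 0).obj.card) : (NCS ε).X n :=
  normalizedMk (gabrielZisman (symBar k (augIdeal ε))) n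
    (gabrielZismanGen (symBar k (augIdeal ε)) s y)

/-- The submodule `NCS^1_n(I)` generated by the classes of the generators whose string does not end
in the one-element set. -/
noncomputable def NCSOne (n : ℕ) : Submodule k ((NCS ε).X n) :=
  Submodule.span k {z | ∃ (s : ComposableArrows EpiDeltaS n)
    (y : TPow k (augIdeal ε) (s.obj 0).obj.card),
      (s.obj (Fin.last n)).obj.card ≠ 1 ∧ z = symGen ε s y}

theorem NCSOne_d (i j : ℕ) : NCSOne ε i ≤ (NCSOne ε j).comap ((NCS ε).d i j).hom := by
  by_cases hij : j + 1 = i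
  swap
  · rw [HomologicalComplex.shape _ i j hij]
    intro x _
    simp
  subst hij
  rw [NCSOne, Submodule.span_le]
  rintro _ ⟨s, y, hs, rfl⟩
  rw [SetLike.mem_coe, Submodule.mem_comap]
  have hd : ((NCS ε).d (j + 1) j).hom (symGen ε s y) =
      normalizedMk (gabrielZisman (symBar k (augIdeal ε))) j
        ((AlgebraicTopology.AlternatingFaceMapComplex.objD
          (gabrielZisman (symBar k (augIdeal ε))) j).hom
            (gabrielZismanGen (symBar k (augIdeal ε)) s y)) := by
    rw [← AlgebraicTopology.alternatingFaceMapComplex_obj_d]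
    rfl
  rw [hd, AlgebraicTopology.AlternatingFaceMapComplex.objD, ModuleCat.hom_sum,
    LinearMap.sum_apply, map_sum]
  refine Submodule.sum_mem _ fun l _ => ?_
  rw [ModuleCat.hom_zsmul, LinearMap.smul_apply, map_zsmul]
  refine zsmul_mem (Submodule.subset_span ?_) _
  refine ⟨pullString (SimplexCategory.δ l) s,
    symBarMap k (augIdeal ε) (initialMap (SimplexCategory.δ l) s) y, ?_, ?_⟩
  · have hsurj := EpiDeltaS.surjective
      (s.map (homOfLE (Fin.le_last ((SimplexCategory.δ l).toOrderHom (Fin.last j)))))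
    have h1 := Fintype.card_le_of_surjective _ hsurj
    simp only [Fintype.card_fin] at h1
    have h2 := (s.obj (Fin.last (j + 1))).obj.pos
    intro h3
    have h4 : (s.obj ((SimplexCategory.δ l).toOrderHom (Fin.last j))).obj.card = 1 := h3
    omega
  · exact congrArg (normalizedMk (gabrielZisman (symBar k (augIdeal ε))) j)
      (gzMap_incl (symBar k (augIdeal ε)) (SimplexCategory.δ l) s y)

/-- The quotient complex `NCS_*(I) / NCS^1_*(I)`. -/
noncomputable def NCSBar : ChainComplex (ModuleCat.{max u v} k) ℕ :=
  quotientComplex (NCS ε) (NCSOne ε) (NCSOne_d ε)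

/-- The quotient map `q : NCS_*(I) ⟶ NCS_*(I) / NCS^1_*(I)`. -/
noncomputable def quotMap : NCS ε ⟶ NCSBar ε :=
  quotientComplexMk (NCS ε) (NCSOne ε) (NCSOne_d ε)

/-- The normalized complex `NCΓ_*(I, k)` of the simplicial module `C Γ_*(I, k)`, where `A` acts on
`k` through the augmentation. -/
noncomputable def NCGamma : ChainComplex (ModuleCat.{max u v} k) ℕ :=
  normalizedComplex (robinsonWhitehouse k (augIdeal ε) (AugCoeff ε))

/-- The class in `NCΓ_n(I, k)` of the generator `[s] ⊗ y ⊗ c`. -/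
noncomputable def gammaGen {n : ℕ} (s : OneString n) (y : TPow k (augIdeal ε) (s.1.obj 0).card)
    (c : k) : (NCGamma ε).X n :=
  normalizedMk (robinsonWhitehouse k (augIdeal ε) (AugCoeff ε)) n
    (robinsonWhitehouseGen k (augIdeal ε) (AugCoeff ε) s y c)

end Augmented

end SymGamma

/-! The comparison already exists before normalizing, as a map of simplicial modules $CS_\star(I)\to
C\Gamma_\star(I,k)$: a generator $(s,y)$ goes to $[U(s)]\otimes y\otimes 1$ if $s$ ends in
$\underline 1$, and to $0$ otherwise (`comparisonMap`). A simplicial map preserves degenerate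
elements, so it induces a chain map of normalized complexes. This chain map kills $NCS^1_\star(I)$
by construction, and $\Phi$ is what it induces on the quotient.

Compatibility with the simplicial structure (`comparisonMap_naturality`) is checked for an arbitrary
map $\theta$ of the simplex category. As $A$ is commutative, $B_I^{sym}(f)$ depends only on the
underlying surjection $U(f)$, so the two sides agree whenever $\theta^*s$ ends in $\underline 1$. If
$s$ ends in $\underline 1$ but $\theta^*s$ does not, the symmetric side gives $0$ by definition of
the comparison. On the Robinson–Whitehouse side every summand moves a non-empty product of elements
of $I=\ker\varepsilon$ onto the coefficient module $k$, where it acts as zero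
(`rwMap_incl_of_card_ne_one`). If $s$ does not end in $\underline 1$, neither does $\theta^*s$,
because an earlier object of $s$ surjects onto the last one.

For surjectivity, $U$ is bijective on objects and full: every surjection becomes a morphism of
$\Delta S$ by sorting, and that morphism is epi (`forgetOrder_full`). Strings are determined by
their consecutive maps, so every string in $\Omega$ lifts (`exists_comp_forgetOrder`), and a
coefficient $c\in k$ can be absorbed into the tensor $y$. Hence the comparison is surjective before
normalizing (`comparisonMap_surjective`), and therefore also after it. -/

namespace SymGamma

universe u v w

/-! ### Lifting strings of surjections along $U$ -/

section Lifting

/-- If `φ` is surjective then the permutation `φ^*(h)` determines `h`. -/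
theorem DeltaS.pullPerm_injective {n m : ℕ} (φ : Fin n →o Fin m) (hφ : Function.Surjective φ) :
    Function.Injective (DeltaS.pullPerm φ) := by
  intro h h' e
  -- The permutation $\varphi^*(h)$ sorts by the value of $h\circ\varphi$, so it records the order
  -- in which $h$ places the fibres of $\varphi$.
  have key : ∀ (h : Equiv.Perm (Fin m)) (i j : Fin n), h (φ i) < h (φ j) →
      DeltaS.pullPerm φ h i < DeltaS.pullPerm φ h j := by
    intro h i j hlt
    by_contra hle
    have := ((DeltaS.pullPerm_eq_iff φ h _).1 rfl).1 (not_lt.1 hle)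
    simp only [Equiv.Perm.coe_inv, Equiv.symm_apply_apply] at this
    exact absurd hlt (not_lt.2 this)
  -- Since every fibre is non-empty, equal pullbacks mean that $h$ and $h'$ place the fibres in the
  -- same order. So $h'\circ h^{-1}$ is strictly increasing with full range, which forces it to be
  -- the identity.
  have hmono : StrictMono (h' ∘ h.symm) := by
    intro a b hab
    obtain ⟨i, hi⟩ := hφ (h.symm a)
    obtain ⟨j, hj⟩ := hφ (h.symm b)
    have h1 := key h i j (by simpa [hi, hj] using hab)
    simp only [Function.comp_apply, ← hi, ← hj]
    rcases lt_trichotomy (h' (φ i)) (h' (φ j)) with h2 | h2 | h2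
    · exact h2
    · rw [h'.injective.eq_iff, hi, hj, h.symm.injective.eq_iff] at h2
      exact absurd h2 hab.ne
    · have h3 := key h' j i h2
      rw [← e] at h3
      exact absurd h1 h3.not_gt
  have hrange : Set.range (h' ∘ h.symm) = Set.range (id : Fin m → Fin m) := by
    rw [(h'.surjective.comp h.symm.surjective).range_eq, Set.range_id]
  have hid := (StrictMono.range_inj hmono strictMono_id).1 hrange
  ext1 a
  have := congrFun hid (h a)
  simpa using this.symm

/-- A morphism of `ΔS` with surjective underlying map is an epimorphism. -/
theorem DeltaS.epi_of_surjective {a b : DeltaS} (f : a ⟶ b)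
    (hf : Function.Surjective (DeltaS.Hom.toFun f)) : Epi f where
  left_cancellation {c} p q e := by
    have hφ : Function.Surjective (DeltaS.Hom.φ f) := fun j => (hf j).imp' _ fun _ hi => hi
    refine DeltaS.Hom.ext_toFun (DeltaS.pullPerm_injective (DeltaS.Hom.φ f) hφ ?_) fun j => ?_
    -- The permutation part of `f ≫ p` is $\varphi^*(h)\cdot g$, with $h$ that of `p` and $\varphi$,
    -- $g$ those of `f`; the common factor $g$ cancels.
    · exact mul_right_cancel (congrArg DeltaS.Hom.g e)
    · obtain ⟨i, rfl⟩ := hf j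
      have h := congrFun (congrArg DeltaS.Hom.toFun e) i
      rwa [DeltaS.toFun_comp, DeltaS.toFun_comp] at h

/-- Every map of sets underlies a morphism of `ΔS`. -/
theorem DeltaS.exists_toFun_eq {a b : DeltaS} (f : Fin a.card → Fin b.card) :
    ∃ p : a ⟶ b, DeltaS.Hom.toFun p = f :=
  -- Sorting the source by the value of `f` makes `f` order-preserving; the inverse of the sorting
  -- permutation undoes the change.
  ⟨(⟨⟨f ∘ Tuple.sort f, Tuple.monotone_sort f⟩, (Tuple.sort f)⁻¹⟩ : DeltaS.Hom a b), by
    funext i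
    simp [DeltaS.Hom.toFun]⟩

/-- The sorted lift of a surjection is a morphism of $\mathrm{Epi}\Delta S$ because surjectivity of
the underlying map suffices for being epi in $\Delta S$. -/
instance forgetOrder_full : forgetOrder.Full where
  map_surjective {a b} f := by
    obtain ⟨p, hp⟩ := DeltaS.exists_toFun_eq (a := a.obj) (b := b.obj) f.1
    have : Function.Surjective (DeltaS.Hom.toFun p) := hp ▸ f.2
    exact ⟨⟨p, DeltaS.epi_of_surjective p this⟩, Subtype.ext hp⟩

/-- Every string in `Ω` lifts to a string in `Epi ΔS`. -/
theorem exists_comp_forgetOrder {n : ℕ} (s : ComposableArrows Omega n) :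
    ∃ S : ComposableArrows EpiDeltaS n, S ⋙ forgetOrder = s := by
  let obj : Fin (n + 1) → EpiDeltaS := fun i => ⟨⟨(s.obj i).card, (s.obj i).pos⟩⟩
  have hmap : ∀ i : Fin n, ∃ p : obj i.castSucc ⟶ obj i.succ,
      forgetOrder.map p = s.map (homOfLE (Fin.castSucc_le_succ i)) :=
    fun i => forgetOrder.map_surjective (X := obj i.castSucc) (Y := obj i.succ) _
  choose p hp using hmap
  -- The consecutive maps are lifted independently: a string on a linear order imposes no relations
  -- between them. The objects agree definitionally, so the transports in the comparison of maps are
  -- identities.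
  refine ⟨ComposableArrows.mkOfObjOfMapSucc obj p, ComposableArrows.ext (fun i => rfl) ?_⟩
  intro i hi
  refine Eq.trans (congrArg forgetOrder.map
    (ComposableArrows.mkOfObjOfMapSucc_map_succ obj p i hi)) ((hp ⟨i, hi⟩).trans ?_)
  exact ((Category.id_comp _).trans (Category.comp_id _)).symm

end Lifting

/-! ### Chain maps on quotient and normalized complexes -/

section Descent

variable {k : Type u} [CommRing k]

/-- A chain map that vanishes on a subcomplex descends to the quotient complex. -/
noncomputable def quotientComplexDesc (C : ChainComplex (ModuleCat.{w} k) ℕ)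
    (D : ∀ n, Submodule k (C.X n)) (h : ∀ i j, D i ≤ (D j).comap (C.d i j).hom)
    {E : ChainComplex (ModuleCat.{w} k) ℕ} (φ : C ⟶ E)
    (hφ : ∀ n, D n ≤ LinearMap.ker (φ.f n).hom) : quotientComplex C D h ⟶ E where
  f n := ModuleCat.ofHom ((D n).liftQ (φ.f n).hom (hφ n))
  comm' i j _ := by
    refine ModuleCat.hom_ext (Submodule.linearMap_qext _ (LinearMap.ext fun x => ?_))
    exact congrArg (fun f => f.hom x) (φ.comm i j)

/-- Naturality of `f` with respect to the degeneracies; this is what lets a simplicial map pass to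
normalized complexes. In degree $0$ the degenerate part is zero. -/
theorem degenerate_le_comap {X Y : SimplicialObject (ModuleCat.{w} k)} (f : X ⟶ Y) (n : ℕ) :
    degenerate X n ≤ (degenerate Y n).comap (f.app (Opposite.op ⦋n⦌)).hom := by
  cases n with
  | zero => exact bot_le
  | succ n =>
    refine iSup_le fun i => ?_
    rintro _ ⟨x, rfl⟩
    refine range_σ_le Y i ⟨(f.app (Opposite.op ⦋n⦌)).hom x, ?_⟩
    exact (congrArg (fun g => g.hom x) (f.naturality (SimplexCategory.σ i).op)).symm

/-- The chain map between normalized complexes induced by a map of simplicial `k`-modules. -/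
noncomputable def normalizedComplexMap {X Y : SimplicialObject (ModuleCat.{w} k)} (f : X ⟶ Y) :
    normalizedComplex X ⟶ normalizedComplex Y :=
  quotientComplexDesc _ _ _
    ((AlgebraicTopology.alternatingFaceMapComplex _).map f ≫
      quotientComplexMk _ (degenerate Y) (degenerate_d Y))
    fun n _ hx => (Submodule.Quotient.mk_eq_zero _).2 (degenerate_le_comap f n hx)

end Descent

/-! ### The simplicial comparison map and its surjectivity -/

section Comparison

variable {k : Type u} [CommRing k] {A : Type v} [CommRing A] [Algebra k A] (ε : A →ₐ[k] k)

/-- The action is through $\varepsilon$, and a product with at least one factor in $\ker\varepsilon$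
stays there. Non-emptiness is essential: the empty product acts as the identity. -/
theorem prod_augIdeal_smul {ι : Type*} {S : Finset ι} (hS : S.Nonempty) (c : ι → augIdeal ε)
    (μ : AugCoeff ε) : (∏ j ∈ S, (c j : A)) • μ = 0 := by
  obtain ⟨i, hi⟩ := hS
  have h : ε (∏ j ∈ S, (c j : A)) = 0 := (augIdeal ε).prod_mem (i := i) hi (c i).2
  change ε (∏ j ∈ S, (c j : A)) * (show k from μ) = 0
  rw [h, zero_mul]

/-- If `θ^* s` does not end in the one-element set, then `θ` acts as zero on the summand of `s` in
`C Γ_*(I, k)`, as the augmentation ideal acts trivially on `k`. -/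
theorem rwMap_incl_of_card_ne_one {x y : SimplexCategory} (θ : y ⟶ x) (s : OneString x.len)
    (h : ((pullString θ s.1).obj (Fin.last y.len)).card ≠ 1)
    (a : Fin (s.1.obj 0).card → augIdeal ε) (μ : AugCoeff ε) :
    rwMap k (augIdeal ε) (AugCoeff ε) θ
      (rwIncl k (augIdeal ε) (AugCoeff ε) x.len s (PiTensorProduct.tprod k a ⊗ₜ μ)) = 0 := by
  rw [rwMap_incl]
  refine Finset.sum_eq_zero fun i _ => ?_
  -- The final codomain has a second element $j\neq i$, and by surjectivity $j$ has a preimage in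
  -- the initial domain; the corresponding tensor factor is moved onto $k$.
  have hne : ((fibre (pullString θ s.1) i 0)ᶜ).Nonempty := by
    have hpos := ((pullString θ s.1).obj (Fin.last y.len)).pos
    have : Nontrivial (Fin ((pullString θ s.1).obj (Fin.last y.len)).card) :=
      Fin.nontrivial_iff_two_le.2 (by omega)
    obtain ⟨j, hj⟩ := exists_ne i
    obtain ⟨r, rfl⟩ := strMap_surjective (pullString θ s.1) (Fin.zero_le (Fin.last y.len)) j
    exact ⟨r, Finset.mem_compl.2 fun hr => hj (mem_fibre.1 hr)⟩
  rw [prod_augIdeal_smul ε hne, TensorProduct.tmul_zero, map_zero]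

/-- The comparison map on the summand of the string `s`: it sends `y` to `[U s] ⊗ y ⊗ 1` if `s`
ends in the one-element set, and to zero otherwise. -/
noncomputable def comparisonTerm {n : ℕ} (s : ComposableArrows EpiDeltaS n) :
    (symBar k (augIdeal ε)).obj (s.obj 0) →ₗ[k] RWModule k (augIdeal ε) (AugCoeff ε) n :=
  if h : (s.obj (Fin.last n)).obj.card = 1 then
    rwIncl k (augIdeal ε) (AugCoeff ε) n ⟨s ⋙ forgetOrder, h⟩ ∘ₗ
      (TensorProduct.mk k (TPow k (augIdeal ε) (s.obj 0).obj.card) (AugCoeff ε)).flip (1 : k)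
  else 0

open Classical in
/-- The comparison map from `CS_n(I)` to `C Γ_n(I, k)`: it sends the generator
`((f_n, …, f_1), y)` to `[U f_n | ⋯ | U f_1] ⊗ y ⊗ 1` if the string ends in the one-element set,
and to zero otherwise. -/
noncomputable def comparisonMap (n : ℕ) :
    (DirectSum (ComposableArrows EpiDeltaS n) fun s => (symBar k (augIdeal ε)).obj (s.obj 0)) →ₗ[k]
      RWModule k (augIdeal ε) (AugCoeff ε) n :=
  DirectSum.toModule k _ _ (comparisonTerm ε)

theorem comparisonMap_incl {n : ℕ} (s : ComposableArrows EpiDeltaS n)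
    (y : (symBar k (augIdeal ε)).obj (s.obj 0)) :
    comparisonMap ε n (gzIncl (symBar k (augIdeal ε)) n s y) = comparisonTerm ε s y := by
  rw [comparisonMap, DirectSum.toModule_lof]

theorem comparisonMap_incl_of_card_eq_one {n : ℕ} (s : ComposableArrows EpiDeltaS n)
    (h : (s.obj (Fin.last n)).obj.card = 1) (y : TPow k (augIdeal ε) (s.obj 0).obj.card) :
    comparisonMap ε n (gzIncl (symBar k (augIdeal ε)) n s y) =
      rwIncl k (augIdeal ε) (AugCoeff ε) n ⟨s ⋙ forgetOrder, h⟩ (y ⊗ₜ[k] (1 : k)) :=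
  (comparisonMap_incl ε s y).trans (LinearMap.congr_fun (dif_pos h) y)

theorem comparisonMap_incl_of_card_ne_one {n : ℕ} (s : ComposableArrows EpiDeltaS n)
    (h : (s.obj (Fin.last n)).obj.card ≠ 1) (y : TPow k (augIdeal ε) (s.obj 0).obj.card) :
    comparisonMap ε n (gzIncl (symBar k (augIdeal ε)) n s y) = 0 :=
  (comparisonMap_incl ε s y).trans (LinearMap.congr_fun (dif_neg h) y)

/-- Used to see that a string whose last object is not $\underline 1$ never passes through
$\underline 1$. -/
theorem EpiDeltaS.card_le {a b : EpiDeltaS} (f : a ⟶ b) : b.obj.card ≤ a.obj.card := by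
  simpa using Fintype.card_le_of_surjective _ (EpiDeltaS.surjective f)

/-- There are three cases, according to whether $s$ and $\theta^*s$ end in $\underline 1$. The mixed
case, typified by the last face, is the one that needs trivial coefficients. -/
theorem comparisonMap_naturality {x y : SimplexCategory} (θ : y ⟶ x) :
    comparisonMap ε y.len ∘ₗ gzMap (symBar k (augIdeal ε)) θ =
      rwMap k (augIdeal ε) (AugCoeff ε) θ ∘ₗ comparisonMap ε x.len := by
  classical
  refine DirectSum.linearMap_ext _ fun s => PiTensorProduct.ext (MultilinearMap.ext fun a => ?_)
  -- On pure tensors the symmetric side multiplies along the fibres of the underlying surjection,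
  -- exactly as $f_\star$ does over $\Omega$; the fibre orders have dropped out.
  have hgz : gzMap (symBar k (augIdeal ε)) θ
      (gzIncl (symBar k (augIdeal ε)) x.len s (PiTensorProduct.tprod k a)) =
      gzIncl (symBar k (augIdeal ε)) y.len (pullString θ s) (PiTensorProduct.tprod k
        (pushVec (DeltaS.Hom.toFun (initialMap θ s).hom)
          (EpiDeltaS.surjective (initialMap θ s)) a)) :=
    (gzMap_incl _ θ s _).trans (congrArg (gzIncl (symBar k (augIdeal ε)) y.len (pullString θ s))
      (symBarMap_tprod k (augIdeal ε) (initialMap θ s) a))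
  change comparisonMap ε y.len (gzMap (symBar k (augIdeal ε)) θ
      (gzIncl (symBar k (augIdeal ε)) x.len s (PiTensorProduct.tprod k a))) =
    rwMap k (augIdeal ε) (AugCoeff ε) θ (comparisonMap ε x.len
      (gzIncl (symBar k (augIdeal ε)) x.len s (PiTensorProduct.tprod k a)))
  rw [hgz]
  by_cases hs : (s.obj (Fin.last x.len)).obj.card = 1
  · rw [comparisonMap_incl_of_card_eq_one ε s hs]
    by_cases ht : ((pullString θ s).obj (Fin.last y.len)).obj.card = 1
    · rw [comparisonMap_incl_of_card_eq_one ε _ ht]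
      -- Restriction along $\theta$ and composition with $U$ commute definitionally, so both sides
      -- are indexed by the same string.
      exact (rwMap_incl_of_card_eq_one k (augIdeal ε) (AugCoeff ε) θ
        ⟨s ⋙ forgetOrder, hs⟩ ht a (1 : k)).symm
    · rw [comparisonMap_incl_of_card_ne_one ε _ ht]
      exact (rwMap_incl_of_card_ne_one ε θ ⟨s ⋙ forgetOrder, hs⟩ ht a (1 : k)).symm
  -- The last object of $\theta^*s$ is an object of $s$ that surjects onto the last object of $s$,
  -- hence has at least two elements; both sides vanish.
  · have ht : ((pullString θ s).obj (Fin.last y.len)).obj.card ≠ 1 := by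
      have h1 := EpiDeltaS.card_le (s.map (homOfLE (Fin.le_last (θ.toOrderHom (Fin.last y.len)))))
      have h2 := (s.obj (Fin.last x.len)).obj.pos
      change (s.obj (θ.toOrderHom (Fin.last y.len))).obj.card ≠ 1
      omega
    rw [comparisonMap_incl_of_card_ne_one ε s hs, comparisonMap_incl_of_card_ne_one ε _ ht,
      map_zero]

/-- It suffices to reach the generators $[s]\otimes y\otimes c$: lift $s$ along $U$ and use
$y\otimes c=cy\otimes 1$. -/
theorem comparisonMap_surjective (n : ℕ) : Function.Surjective (comparisonMap ε n) := by
  classical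
  rw [← LinearMap.range_eq_top, eq_top_iff]
  rintro z -
  induction z using DirectSum.induction_on with
  | zero => exact zero_mem _
  | add z z' hz hz' => exact add_mem hz hz'
  | of s t =>
    induction t using TensorProduct.induction_on with
    | zero => rw [map_zero]; exact zero_mem _
    | add t t' ht ht' => rw [map_add]; exact add_mem ht ht'
    | tmul y c =>
      obtain ⟨s, hs⟩ := s
      obtain ⟨S, rfl⟩ := exists_comp_forgetOrder s
      -- The coefficient module is $k$ itself, so `c` can be read as a scalar and moved across the
      -- tensor sign.
      let d : k := c
      let y' : TPow k (augIdeal ε) (S.obj 0).obj.card := y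
      refine ⟨gzIncl (symBar k (augIdeal ε)) n S (d • y'),
        (comparisonMap_incl_of_card_eq_one ε S hs (d • y')).trans ?_⟩
      have h : (d • y') ⊗ₜ[k] (show AugCoeff ε from (1 : k)) = y' ⊗ₜ[k] c := by
        rw [TensorProduct.smul_tmul]
        exact congrArg (fun x : AugCoeff ε => y' ⊗ₜ[k] x) (mul_one d)
      exact congrArg (rwIncl k (augIdeal ε) (AugCoeff ε) n ⟨S ⋙ forgetOrder, hs⟩) h

/-- The comparison map of simplicial `k`-modules from `CS_*(I)` to `C Γ_*(I, k)`. -/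
noncomputable def comparison :
    gabrielZisman (symBar k (augIdeal ε)) ⟶ robinsonWhitehouse k (augIdeal ε) (AugCoeff ε) where
  app x := ModuleCat.ofHom (comparisonMap ε x.unop.len)
  naturality _ _ θ := ModuleCat.hom_ext (comparisonMap_naturality ε θ.unop)

theorem normalizedComplexMap_comparison_symGen {n : ℕ} (s : ComposableArrows EpiDeltaS n)
    (h : (s.obj (Fin.last n)).obj.card = 1) (y : TPow k (augIdeal ε) (s.obj 0).obj.card) :
    ((normalizedComplexMap (comparison ε)).f n).hom (symGen ε s y) =
      gammaGen ε ⟨s ⋙ forgetOrder, h⟩ y 1 :=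
  congrArg (normalizedMk (robinsonWhitehouse k (augIdeal ε) (AugCoeff ε)) n)
    (comparisonMap_incl_of_card_eq_one ε s h y)

/-- The comparison is zero on the spanning generators by definition; this is the condition for
$\Phi$ to exist on the quotient. -/
theorem NCSOne_le_ker (n : ℕ) :
    NCSOne ε n ≤ LinearMap.ker ((normalizedComplexMap (comparison ε)).f n).hom := by
  refine Submodule.span_le.2 ?_
  rintro _ ⟨s, y, hs, rfl⟩
  exact (congrArg (normalizedMk (robinsonWhitehouse k (augIdeal ε) (AugCoeff ε)) n)
    (comparisonMap_incl_of_card_ne_one ε s hs y)).trans (map_zero _)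

/-- The chain map `Φ : NCS_*(I) / NCS^1_*(I) ⟶ NCΓ_*(I, k)`. -/
noncomputable def barComparison : NCSBar ε ⟶ NCGamma ε :=
  quotientComplexDesc (NCS ε) (NCSOne ε) (NCSOne_d ε) (normalizedComplexMap (comparison ε))
    (NCSOne_le_ker ε)

end Comparison

end SymGamma

/-! ### The theorem -/

theorem mainTheorem2 {k : Type*} [CommRing k] {A : Type*} [CommRing A] [Algebra k A]
    (ε : A →ₐ[k] k) :
    ∃ Φ : SymGamma.NCSBar ε ⟶ SymGamma.NCGamma ε,
      (∀ (n : ℕ) (s : CategoryTheory.ComposableArrows SymGamma.EpiDeltaS n)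
        (hs : (s.obj (Fin.last n)).obj.card = 1)
        (y : SymGamma.TPow k (SymGamma.augIdeal ε) (s.obj 0).obj.card),
        (Φ.f n).hom (((SymGamma.quotMap ε).f n).hom (SymGamma.symGen ε s y)) =
          SymGamma.gammaGen ε ⟨s ⋙ SymGamma.forgetOrder, hs⟩ y 1) ∧
      ∀ n : ℕ, Function.Surjective ((SymGamma.quotMap ε ≫ Φ).f n).hom := by
  refine ⟨SymGamma.barComparison ε,
    fun n s hs y => SymGamma.normalizedComplexMap_comparison_symGen ε s hs y, fun n z => ?_⟩
  -- A class in $NC\Gamma_n(I,k)$ is lifted to $C\Gamma_n(I,k)$, then along the comparison to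
  -- $CS_n(I)$. The class of that lift is a preimage, since $\Phi\circ q$ acts on representatives by
  -- the comparison.
  obtain ⟨z, rfl⟩ := Submodule.mkQ_surjective _ z
  obtain ⟨w, rfl⟩ := SymGamma.comparisonMap_surjective ε n z
  exact ⟨SymGamma.normalizedMk _ n w, rfl⟩
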